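/- Let $r\in\{0,1\}$ and let $(M^{r,3-r},\phi,\xi,\eta,g)$ be a three-dimensional Riemannian ($r=0$) or Lorentzian ($r=1$, $g(\xi,\xi)=-1$) Sasakian space-form with $\phi$-sectional curvature $H$, i.e. a simply connected contact metric manifold with $R(X,Y)\xi=\eta(Y)X-\eta(X)Y$ all of whose $\phi$-sectional curvatures equal the constant $H$. Orient $M$ by $\eta\wedge d\eta$ (and time-orient it by $\xi$ if $r=1$), fix a spin structure, use the Clifford convention $X\cdot Y+Y\cdot X=-2g(X,Y)$ with $\gamma_1=(-\sqrt{-1})^{r-1}\sigma_1$, $\gamma_2=\sqrt{-1}\sigma_2$, $\gamma_3=\sqrt{-1}\sigma_3$ ($\sigma_i$ the Pauli matrices), and the spin-invariant form $\langle\psi_1,\psi_2\rangle=\psi_1^\dagger(\gamma_1)^r\psi_2$. An SqK-spinor of type $(a,b)$, $a,b\in\mathbb R$, is a spinor field with $$\nabla_X\psi=a(\sqrt{-1})^rX\cdot\psi+b(\sqrt{-1})^r\eta(X)\,\xi\cdot\psi\quad\text{for all }X.$$ Consider, with $s=\sqrt{(-1)^rH+3}$, the cases (i) $(a,b)=\left(\frac{(-1)^r}{2},\frac{H-(-1)^r}{4}\right)$,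 $\ \lambda=\frac{(-1)^{r-1}H-5}{4}$, $\ \Lambda=(-1)^{r-1}$; (ii) $(-1)^rH>-3$, and moreover $H<1$ if $r=0$; $(a,b)=\left(\frac{(-1)^r+s}{2},-\frac s2+(-1)^{r-1}\right)$, $\ \lambda=(-1)^{r-1}s-\frac12$, $\ \Lambda=-s+H+2(-1)^r$; (iii) $(-1)^rH>-3$; $(a,b)=\left(\frac{(-1)^r-s}{2},\frac s2+(-1)^{r-1}\right)$, $\ \lambda=(-1)^rs-\frac12$, $\ \Lambda=s+H+2(-1)^r$. In each case assume that $\lambda\ne0$ and that $S-6\Lambda$ vanishes nowhere, where $S$ is the scalar curvature. Let $\psi$ be a non-null SqK-spinor of the type $(a,b)$ of that case ($\langle\psi,\psi\rangle$ vanishes nowhere). Then: 1. If $r=0$, then $-\frac{S-6\Lambda}{\lambda\langle\psi,\psi\rangle}>0$ on $M$. 2. If $-\frac{S-6\Lambda}{\lambda\langle\psi,\psi\rangle}>0$ on $M$, then the pair $\left(g,\tilde\psi\right)$ with $\tilde\psi=\sqrt{-\frac{S-6\Lambda}{\lambda\langle\psi,\psi\rangle}}\;\psi$ solves the Einstein–Dirac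 system with eigenvalue $\lambda$ and cosmological constant $\Lambda$: $$D\tilde\psi=\lambda\tilde\psi,\qquad \mathrm{Ric}=T-\mathrm{tr}(T)\,g+2\Lambda g,$$ where $D=(\sqrt{-1})^r\sum_k\gamma^k\nabla_{e_k}$ and $T(X,Y)=\frac14\,\mathrm{Re}\,\langle\tilde\psi,(\sqrt{-1})^r(X\cdot\nabla_Y\tilde\psi+Y\cdot\nabla_X\tilde\psi)\rangle$. 3. If $r=1$, the sign can be chosen: there is an SqK-spinor $\chi$ of the same type $(a,b)$ with $\langle\chi,\chi\rangle=-\langle\psi,\psi\rangle$, and for at least one of $\psi$, $\chi$ the quantity in 2 is positive on $M$, so that the correspondingly rescaled spinor solves the Einstein–Dirac system with $\lambda$ and $\Lambda$. -/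

import Mathlib

open scoped Manifold ContDiff Matrix
open Bundle

noncomputable section

namespace SqK

/-- The model space of three-dimensional manifolds. -/
abbrev E3 : Type := EuclideanSpace ℝ (Fin 3)

/-! ### Vector fields, metrics, Levi-Civita connection, curvature -/

section Geometry

variable {M : Type*} [TopologicalSpace M] [ChartedSpace E3 M] [IsManifold 𝓘(ℝ, E3) ∞ M]

/-- `X` is a smooth vector field near `x`. -/
def SmoothAt (X : Π x : M, TangentSpace 𝓘(ℝ, E3) x) (x : M) : Prop :=
  ContMDiffAt 𝓘(ℝ, E3) (𝓘(ℝ, E3).prod 𝓘(ℝ, E3)) ∞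
    (fun y ↦ (TotalSpace.mk' E3 y (X y) : TangentBundle 𝓘(ℝ, E3) M)) x

/-- `X` is a vector field differentiable at `x`. -/
def DiffAt (X : Π x : M, TangentSpace 𝓘(ℝ, E3) x) (x : M) : Prop :=
  MDifferentiableAt 𝓘(ℝ, E3) (𝓘(ℝ, E3).prod 𝓘(ℝ, E3))
    (fun y ↦ (TotalSpace.mk' E3 y (X y) : TangentBundle 𝓘(ℝ, E3) M)) x

/-- The diagonal entries `((-1)^r, 1, 1)` of the standard metric of index `r`, `r = 0, 1`. -/
def sgn (r : ℕ) (k : Fin 3) : ℝ := if k = 0 then (-1) ^ r else 1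

variable (M) in
/-- A smooth pseudo-Riemannian metric of signature `((-1)^r, 1, 1)`: Riemannian for `r = 0`,
Lorentzian for `r = 1`. -/
structure PseudoMetric (r : ℕ) where
  /-- the scalar product on each tangent space -/
  g (x : M) : TangentSpace 𝓘(ℝ, E3) x →L[ℝ] TangentSpace 𝓘(ℝ, E3) x →L[ℝ] ℝ
  symm (x : M) (v w : TangentSpace 𝓘(ℝ, E3) x) : g x v w = g x w v
  signature (x : M) : ∃ f : Fin 3 → TangentSpace 𝓘(ℝ, E3) x,
    ∀ i j, g x (f i) (f j) = if i = j then sgn r i else 0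
  smooth : ContMDiff 𝓘(ℝ, E3) (𝓘(ℝ, E3).prod 𝓘(ℝ, E3 →L[ℝ] E3 →L[ℝ] ℝ)) ∞
    (fun x ↦ TotalSpace.mk' (E3 →L[ℝ] E3 →L[ℝ] ℝ)
      (E := fun x : M ↦ TangentSpace 𝓘(ℝ, E3) x →L[ℝ] TangentSpace 𝓘(ℝ, E3) x →L[ℝ] ℝ) x (g x))

variable {r : ℕ}

namespace PseudoMetric

variable (m : PseudoMetric M r)

/-- The right-hand side of the Koszul formula for `2 g(∇_X Y, Z)`. -/
def koszul (X Y Z : Π x : M, TangentSpace 𝓘(ℝ, E3) x) (x : M) : ℝ :=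
  mvfderiv 𝓘(ℝ, E3) (fun y ↦ m.g y (Y y) (Z y)) x (X x)
    + mvfderiv 𝓘(ℝ, E3) (fun y ↦ m.g y (X y) (Z y)) x (Y x)
    - mvfderiv 𝓘(ℝ, E3) (fun y ↦ m.g y (X y) (Y y)) x (Z x)
    + m.g x (VectorField.mlieBracket 𝓘(ℝ, E3) X Y x) (Z x)
    - m.g x (VectorField.mlieBracket 𝓘(ℝ, E3) X Z x) (Y x)
    - m.g x (VectorField.mlieBracket 𝓘(ℝ, E3) Y Z x) (X x)

/-- The Levi-Civita connection: `m.nabla Y x v` is the covariant derivative `∇_v Y` at `x`, namely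
the vector `w` (unique, by non-degeneracy) that satisfies the Koszul formula
`2 g(w, Z) = koszul X Y Z` at `x` for all `X` with `X x = v` and all `Z`. -/
def nabla (Y : Π x : M, TangentSpace 𝓘(ℝ, E3) x) (x : M) (v : TangentSpace 𝓘(ℝ, E3) x) :
    TangentSpace 𝓘(ℝ, E3) x :=
  Classical.epsilon fun w ↦ ∀ X Z : Π x : M, TangentSpace 𝓘(ℝ, E3) x,
    DiffAt X x → DiffAt Z x → X x = v → 2 * m.g x w (Z x) = m.koszul X Y Z x

/-- The curvature `R(X,Y)Z = ∇_X ∇_Y Z - ∇_Y ∇_X Z - ∇_[X,Y] Z` at `x`. -/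
def curv (X Y Z : Π x : M, TangentSpace 𝓘(ℝ, E3) x) (x : M) : TangentSpace 𝓘(ℝ, E3) x :=
  m.nabla (fun y ↦ m.nabla Z y (Y y)) x (X x) - m.nabla (fun y ↦ m.nabla Z y (X y)) x (Y x)
    - m.nabla Z x (VectorField.mlieBracket 𝓘(ℝ, E3) X Y x)

/-- The Ricci tensor `Ric(Y,Z) = tr (V ↦ R(V,Y)Z)` at `x`, the trace being computed in an
orthonormal frame `e` defined near `x`. -/
def ric (e : Fin 3 → Π x : M, TangentSpace 𝓘(ℝ, E3) x) (Y Z : Π x : M, TangentSpace 𝓘(ℝ, E3) x)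
    (x : M) : ℝ :=
  ∑ k, sgn r k * m.g x (m.curv (e k) Y Z x) (e k x)

/-- The scalar curvature at `x`, computed in an orthonormal frame `e` defined near `x`. -/
def scal (e : Fin 3 → Π x : M, TangentSpace 𝓘(ℝ, E3) x) (x : M) : ℝ :=
  ∑ k, sgn r k * m.ric e (e k) (e k) x

end PseudoMetric

/-! ### Sasakian space-forms -/

/-- The exterior derivative of a one-form, normalized as
`dη(X,Y) = (X η(Y) - Y η(X) - η([X,Y])) / 2`. -/
def dForm (eta : (x : M) → TangentSpace 𝓘(ℝ, E3) x →L[ℝ] ℝ)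
    (X Y : Π x : M, TangentSpace 𝓘(ℝ, E3) x) (x : M) : ℝ :=
  (mvfderiv 𝓘(ℝ, E3) (fun y ↦ eta y (Y y)) x (X x)
    - mvfderiv 𝓘(ℝ, E3) (fun y ↦ eta y (X y)) x (Y x)
    - eta x (VectorField.mlieBracket 𝓘(ℝ, E3) X Y x)) / 2

variable (M) in
/-- A three-dimensional contact metric manifold `(M, φ, ξ, η, g)`, Riemannian (`r = 0`) or
Lorentzian with timelike `ξ` (`r = 1`). -/
structure ContactMetric (r : ℕ) extends PseudoMetric M r where
  phi (x : M) : TangentSpace 𝓘(ℝ, E3) x →L[ℝ] TangentSpace 𝓘(ℝ, E3) x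
  xi (x : M) : TangentSpace 𝓘(ℝ, E3) x
  eta (x : M) : TangentSpace 𝓘(ℝ, E3) x →L[ℝ] ℝ
  smooth_phi : ∀ (x : M) (X : Π x : M, TangentSpace 𝓘(ℝ, E3) x), SmoothAt X x →
    SmoothAt (fun y ↦ phi y (X y)) x
  smooth_xi : ∀ x : M, SmoothAt xi x
  smooth_eta : ∀ (x : M) (X : Π x : M, TangentSpace 𝓘(ℝ, E3) x), SmoothAt X x →
    ContMDiffAt 𝓘(ℝ, E3) 𝓘(ℝ, ℝ) ∞ (fun y ↦ eta y (X y)) x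
  eta_xi (x : M) : eta x (xi x) = 1
  phi_phi (x : M) (v : TangentSpace 𝓘(ℝ, E3) x) : phi x (phi x v) = -v + eta x v • xi x
  g_phi_phi (x : M) (v w : TangentSpace 𝓘(ℝ, E3) x) :
    g x (phi x v) (phi x w) = g x v w - (-1) ^ r * eta x v * eta x w
  d_eta : ∀ (x : M) (X Y : Π x : M, TangentSpace 𝓘(ℝ, E3) x), SmoothAt X x → SmoothAt Y x →
    dForm eta X Y x = g x (X x) (phi x (Y x))

/-- A Sasakian space-form with `φ`-sectional curvature `H`: a simply connected contact metric
manifold with `R(X,Y)ξ = η(Y)X - η(X)Y`, all of whose `φ`-sectional curvatures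
`K(X, φX)`, `X ⊥ ξ`, are equal to `H`. -/
structure IsSasakianSpaceForm (c : ContactMetric M r) (H : ℝ) : Prop where
  simplyConnected : SimplyConnectedSpace M
  sasakian : ∀ (x : M) (X Y : Π x : M, TangentSpace 𝓘(ℝ, E3) x), SmoothAt X x → SmoothAt Y x →
    c.curv X Y c.xi x = c.eta x (Y x) • X x - c.eta x (X x) • Y x
  phiSectional : ∀ (x : M) (X : Π x : M, TangentSpace 𝓘(ℝ, E3) x), SmoothAt X x →
    c.eta x (X x) = 0 →
    c.g x (c.curv X (fun y ↦ c.phi y (X y)) (fun y ↦ c.phi y (X y)) x) (X x)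
      = H * (c.g x (X x) (X x) * c.g x (c.phi x (X x)) (c.phi x (X x))
          - c.g x (X x) (c.phi x (X x)) ^ 2)

/-! ### Spin structures and spinors -/

/-- The gamma matrices `γ₁ = (-√-1)^(r-1) σ₁, γ₂ = √-1 σ₂, γ₃ = √-1 σ₃` (indexed by `0, 1, 2`),
where the `σᵢ` are the Pauli matrices; `γᵢ γⱼ + γⱼ γᵢ = -2 sgn(i) δᵢⱼ`. -/
def gam (r : ℕ) : Fin 3 → Matrix (Fin 2) (Fin 2) ℂ :=
  ![(-Complex.I) ^ ((r : ℤ) - 1) • !![0, 1; 1, 0],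
    Complex.I • !![0, -Complex.I; Complex.I, 0],
    Complex.I • !![1, 0; 0, -1]]

/-- The spin-invariant form `⟨ψ₁, ψ₂⟩ = ψ₁† (γ₁)^r ψ₂` on `ℂ²`. -/
def pairing (r : ℕ) (p q : Fin 2 → ℂ) : ℂ := star p ⬝ᵥ (gam r 0 ^ r *ᵥ q)

/-- The real quadratic form `⟨ψ, ψ⟩` on `ℂ²`. -/
def sq (r : ℕ) (p : Fin 2 → ℂ) : ℝ := (pairing r p p).re

/-- Clifford multiplication by the vector `v`, in the orthonormal frame `e`. -/
def cliff (m : PseudoMetric M r) (e : Fin 3 → Π x : M, TangentSpace 𝓘(ℝ, E3) x) (x : M)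
    (v : TangentSpace 𝓘(ℝ, E3) x) : Matrix (Fin 2) (Fin 2) ℂ :=
  ∑ k, ((sgn r k * m.g x v (e k x) : ℝ) : ℂ) • gam r k

/-- A spin structure on a contact metric three-manifold, oriented by `η ∧ dη` and, in the Lorentzian
case, time-oriented by `ξ`: an open cover `U i` with oriented (and time-oriented) smooth orthonormal
frames `e i`, and on the overlaps smooth spin-group valued functions `h i j` (in `SU(2)` for `r = 0`
and in the copy of `SL(2,ℝ)` preserving `⟨ , ⟩` for `r = 1`) that lift the changes of
frame and satisfy the cocycle condition. -/
structure SpinStructure (c : ContactMetric M r) (ι : Type*) where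
  U : ι → Set M
  isOpen : ∀ i, IsOpen (U i)
  cover : ∀ x, ∃ i, x ∈ U i
  e : ι → Fin 3 → Π x : M, TangentSpace 𝓘(ℝ, E3) x
  smooth_e : ∀ i k, ∀ x ∈ U i, SmoothAt (e i k) x
  orthonormal : ∀ i, ∀ x ∈ U i, ∀ k l,
    c.g x (e i k x) (e i l x) = if k = l then sgn r k else 0
  oriented : ∀ i, ∀ x ∈ U i,
    0 < c.eta x (e i 0 x) * dForm c.eta (e i 1) (e i 2) x
      + c.eta x (e i 1 x) * dForm c.eta (e i 2) (e i 0) x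
      + c.eta x (e i 2 x) * dForm c.eta (e i 0) (e i 1) x
  timeOriented : r = 1 → ∀ i, ∀ x ∈ U i, 0 < c.eta x (e i 0 x)
  h : ι → ι → M → Matrix (Fin 2) (Fin 2) ℂ
  smooth_h : ∀ i j a b,
    ContMDiffOn 𝓘(ℝ, E3) 𝓘(ℝ, ℂ) ∞ (fun x ↦ h i j x a b) (U i ∩ U j)
  det_h : ∀ i j, ∀ x ∈ U i ∩ U j, (h i j x).det = 1
  isometry_h : ∀ i j, ∀ x ∈ U i ∩ U j, (h i j x)ᴴ * gam r 0 ^ r * h i j x = gam r 0 ^ r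
  cocycle : ∀ i j k, ∀ x ∈ U i ∩ U j ∩ U k, h i j x * h j k x = h i k x
  lift : ∀ i j, ∀ x ∈ U i ∩ U j, ∀ v : TangentSpace 𝓘(ℝ, E3) x,
    cliff c.toPseudoMetric (e i) x v * h i j x = h i j x * cliff c.toPseudoMetric (e j) x v

namespace SpinStructure

variable {c : ContactMetric M r} {ι : Type*} (S : SpinStructure c ι)

/-- A smooth spinor field (a section of the spinor bundle), given by its components
`ψ i : U i → ℂ²` with `ψ i = h i j ψ j` on the overlaps. Values of `ψ i` outside `U i` are
irrelevant. -/
structure IsSpinor (psi : ι → M → (Fin 2 → ℂ)) : Prop where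
  smooth : ∀ i, ContMDiffOn 𝓘(ℝ, E3) 𝓘(ℝ, Fin 2 → ℂ) ∞ (psi i) (S.U i)
  glue : ∀ i j, ∀ x ∈ S.U i ∩ S.U j, psi i x = S.h i j x *ᵥ psi j x

/-- Clifford multiplication by a tangent vector in the `i`-th frame. -/
def cl (i : ι) (x : M) (v : TangentSpace 𝓘(ℝ, E3) x) : Matrix (Fin 2) (Fin 2) ℂ :=
  cliff c.toPseudoMetric (S.e i) x v

/-- The spinorial Levi-Civita connection in the `i`-th frame,
`∇_v ψ = dψ(v) + (1/4) ∑ g(∇_v e_k, e_l) γ^k γ^l ψ`. -/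
def spinNabla (psi : ι → M → (Fin 2 → ℂ)) (i : ι) (x : M) (v : TangentSpace 𝓘(ℝ, E3) x) :
    Fin 2 → ℂ :=
  mvfderiv 𝓘(ℝ, E3) (psi i) x v
    + ((1 / 4 : ℂ) • ∑ k, ∑ l,
        ((sgn r k * sgn r l * c.g x (c.nabla (S.e i k) x v) (S.e i l x) : ℝ) : ℂ) •
          (gam r k * gam r l)) *ᵥ psi i x

/-- A Sasakian quasi-Killing spinor of type `(a, b)`:
`∇_X ψ = a (√-1)^r X·ψ + b (√-1)^r η(X) ξ·ψ`. -/
structure IsSqK (a b : ℝ) (psi : ι → M → (Fin 2 → ℂ)) : Prop where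
  spinor : S.IsSpinor psi
  eqn : ∀ i, ∀ x ∈ S.U i, ∀ v : TangentSpace 𝓘(ℝ, E3) x,
    S.spinNabla psi i x v
      = ((a : ℂ) * Complex.I ^ r) • (S.cl i x v *ᵥ psi i x)
        + ((b : ℂ) * Complex.I ^ r * (c.eta x v : ℂ)) • (S.cl i x (c.xi x) *ᵥ psi i x)

/-- The spinor is non-null: `⟨ψ, ψ⟩` vanishes nowhere. -/
def NonNull (psi : ι → M → (Fin 2 → ℂ)) : Prop := ∀ i, ∀ x ∈ S.U i, sq r (psi i x) ≠ 0

/-- The Dirac operator `D = (√-1)^r ∑ γ^k ∇_{e_k}` in the `i`-th frame. -/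
def dirac (psi : ι → M → (Fin 2 → ℂ)) (i : ι) (x : M) : Fin 2 → ℂ :=
  Complex.I ^ r • ∑ k, ((sgn r k : ℝ) : ℂ) • (gam r k *ᵥ S.spinNabla psi i x (S.e i k x))

/-- The energy-momentum tensor
`T(X,Y) = (1/4) Re ⟨ψ, (√-1)^r (X·∇_Y ψ + Y·∇_X ψ)⟩` in the `i`-th frame. -/
def energy (psi : ι → M → (Fin 2 → ℂ)) (i : ι) (x : M) (v w : TangentSpace 𝓘(ℝ, E3) x) : ℝ :=
  1 / 4 * (pairing r (psi i x) (Complex.I ^ r •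
    (S.cl i x v *ᵥ S.spinNabla psi i x w + S.cl i x w *ᵥ S.spinNabla psi i x v))).re

/-- The trace of the energy-momentum tensor. -/
def trEnergy (psi : ι → M → (Fin 2 → ℂ)) (i : ι) (x : M) : ℝ :=
  ∑ k, sgn r k * S.energy psi i x (S.e i k x) (S.e i k x)

/-- The scalar curvature of `M`, computed in the `i`-th frame. -/
def scalar (i : ι) (x : M) : ℝ := c.scal (S.e i) x

/-- `(g, ψ)` solves the (three-dimensional) Einstein–Dirac system with eigenvalue `lam` and
cosmological constant `Lam`: `Dψ = λψ` and `Ric = T - tr(T) g + 2 Λ g`. -/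
structure SolvesED (lam Lam : ℝ) (psi : ι → M → (Fin 2 → ℂ)) : Prop where
  spinor : S.IsSpinor psi
  dirac_eq : ∀ i, ∀ x ∈ S.U i, S.dirac psi i x = (lam : ℂ) • psi i x
  einstein_eq : ∀ i, ∀ x ∈ S.U i, ∀ X Y : Π x : M, TangentSpace 𝓘(ℝ, E3) x,
    SmoothAt X x → SmoothAt Y x →
    c.ric (S.e i) X Y x = S.energy psi i x (X x) (Y x)
      - S.trEnergy psi i x * c.g x (X x) (Y x) + 2 * Lam * c.g x (X x) (Y x)

/-- The quantity `-(S - 6Λ) / (λ ⟨ψ, ψ⟩)`. -/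
def ratio (lam Lam : ℝ) (psi : ι → M → (Fin 2 → ℂ)) (i : ι) (x : M) : ℝ :=
  -(S.scalar i x - 6 * Lam) / (lam * sq r (psi i x))

/-- The quantity `-(S - 6Λ) / (λ ⟨ψ, ψ⟩)` is positive on `M`. -/
def RatioPos (lam Lam : ℝ) (psi : ι → M → (Fin 2 → ℂ)) : Prop :=
  ∀ i, ∀ x ∈ S.U i, 0 < S.ratio lam Lam psi i x

/-- The rescaled spinor `√(-(S - 6Λ) / (λ ⟨ψ, ψ⟩)) ψ`. -/
def rescale (lam Lam : ℝ) (psi : ι → M → (Fin 2 → ℂ)) : ι → M → (Fin 2 → ℂ) :=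
  fun i x ↦ ((Real.sqrt (S.ratio lam Lam psi i x) : ℝ) : ℂ) • psi i x

end SpinStructure

end Geometry

/-! ### The three types of spinors -/

/-- The labels of the three types of spinors. -/
inductive Kind
  | i
  | ii
  | iii

namespace Kind

/-- The range of `H` for each type: none for (i), `(-1)^r H > -3` for (ii) and (iii), and moreover
`H < 1` for (ii) in the Riemannian case. -/
def Admissible (r : ℕ) (H : ℝ) : Kind → Prop
  | .i => True
  | .ii => -3 < (-1) ^ r * H ∧ (r = 0 → H < 1)
  | .iii => -3 < (-1) ^ r * H

/-- The first parameter `a` of the spinor. -/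
def a (r : ℕ) (H : ℝ) : Kind → ℝ
  | .i => (-1) ^ r / 2
  | .ii => (-1) ^ r / 2 + Real.sqrt ((-1) ^ r * H + 3) / 2
  | .iii => (-1) ^ r / 2 - Real.sqrt ((-1) ^ r * H + 3) / 2

/-- The second parameter `b` of the spinor. -/
def b (r : ℕ) (H : ℝ) : Kind → ℝ
  | .i => (H - (-1) ^ r) / 4
  | .ii => -Real.sqrt ((-1) ^ r * H + 3) / 2 - (-1) ^ r
  | .iii => Real.sqrt ((-1) ^ r * H + 3) / 2 - (-1) ^ r

/-- The eigenvalue `λ`. -/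
def lam (r : ℕ) (H : ℝ) : Kind → ℝ
  | .i => (-(-1) ^ r * H - 5) / 4
  | .ii => -(-1) ^ r * Real.sqrt ((-1) ^ r * H + 3) - 1 / 2
  | .iii => (-1) ^ r * Real.sqrt ((-1) ^ r * H + 3) - 1 / 2

/-- The cosmological constant `Λ`. -/
def Lam (r : ℕ) (H : ℝ) : Kind → ℝ
  | .i => -(-1) ^ r
  | .ii => -Real.sqrt ((-1) ^ r * H + 3) + H + 2 * (-1) ^ r
  | .iii => Real.sqrt ((-1) ^ r * H + 3) + H + 2 * (-1) ^ r

end Kind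

end SqK

end

set_option linter.unusedSectionVars false

/-! Write `ε = (-1)^r` and `q = ⟨ψ,ψ⟩`. For an SqK-spinor every derivative of `ψ` is a Clifford
expression in `ψ`, so both Einstein–Dirac equations become algebraic. Contracting the spinor
equation gives `Dψ = -ε(3a+b)ψ`, and this number is `λ` in all three cases. The relations `Re ⟨ψ,
X·Y·ψ⟩ = -g(X,Y) q` give `T = -(q/2)(ε a g + b η⊗η)`, hence `tr T = λq/2` (`IsSqK.dirac_eq`,
`IsSqK.energy_eq`, `IsSqK.trEnergy_eq`).

On the geometric side, the Sasakian identity for `R(X,Y)ξ` and the constant `φ`-sectional curvature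
determine all of the Ricci tensor in dimension three: `Ric = (H+ε) g + (1-εH) η⊗η` and `S = 2H+4ε`
(`ContactMetric.trace_riem`, `ContactMetric.scal_eq`). The Einstein equation then amounts to two
scalar conditions: its trace `S - 6Λ = -λq`, and its `η⊗η`-coefficient `bq = -2(1-εH)`. With `μ =
(S-6Λ)/λ` the first says `q = -μ`, which the rescaling produces; the second becomes `bμ = 2(1-εH)`,
a property of the parameters (`Kind.exists_scal_sub_eq`).

Rescaling preserves the spinor equation because its factor is constant: the spin connection and
`(√-1)^r X·` are both infinitesimally skew for `Re ⟨ , ⟩`, so `q` is locally constant, and `M` is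
connected (`IsSqK.exists_sq_eq`). For `r = 0` one has `μ < 0 < q`. For `r = 1` the real structure `ψ
↦ σ₃ψ̄` commutes with everything in the spinor equation and reverses the sign of `q`, so exactly one
of the two signs fits. -/

namespace SqK

open Filter Topology VectorField

/-! ### Calculus of functions and vector fields: derivations and Lie brackets. -/

section FieldCalculus

variable {M : Type*} [TopologicalSpace M] [ChartedSpace E3 M] [IsManifold 𝓘(ℝ, E3) ∞ M]

/-- The smooth functions near `x`. -/
def SmoothFun (f : M → ℝ) (x : M) : Prop := ContMDiffAt 𝓘(ℝ, E3) 𝓘(ℝ, ℝ) ∞ f x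

/-- The functions differentiable at `x`. -/
def DiffFun (f : M → ℝ) (x : M) : Prop := MDifferentiableAt 𝓘(ℝ, E3) 𝓘(ℝ, ℝ) f x

/-- The derivative of a function along a vector field. -/
noncomputable def along (X : Π x : M, TangentSpace 𝓘(ℝ, E3) x) (f : M → ℝ) (x : M) : ℝ :=
  mvfderiv 𝓘(ℝ, E3) f x (X x)

variable {X Y Z : Π x : M, TangentSpace 𝓘(ℝ, E3) x} {f h : M → ℝ} {x : M}


theorem two_le_infty : (2 : WithTop ℕ∞) ≤ ∞ := by
  exact (ENat.LEInfty.out : (2 : WithTop ℕ∞) ≤ ∞)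

theorem SmoothFun.diffFun (hf : SmoothFun f x) : DiffFun f x :=
  ContMDiffAt.mdifferentiableAt hf (by simp)

theorem SmoothFun.mul (hf : SmoothFun f x) (hh : SmoothFun h x) :
    SmoothFun (fun y ↦ f y * h y) x := ContMDiffAt.mul hf hh

theorem SmoothFun.add (hf : SmoothFun f x) (hh : SmoothFun h x) :
    SmoothFun (fun y ↦ f y + h y) x := ContMDiffAt.add hf hh

theorem SmoothFun.sub (hf : SmoothFun f x) (hh : SmoothFun h x) :
    SmoothFun (fun y ↦ f y - h y) x := ContMDiffAt.sub hf hh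

theorem SmoothFun.const (a : ℝ) : SmoothFun (fun _ : M ↦ a) x := contMDiffAt_const

theorem SmoothFun.congr (hf : SmoothFun f x) (hfh : h =ᶠ[𝓝 x] f) : SmoothFun h x :=
  ContMDiffAt.congr_of_eventuallyEq hf hfh

/-- Being `C^∞` at a point need not spread to a neighbourhood, but being `C^1` does; hence the
passage through order one. -/
theorem SmoothFun.eventually_diffFun (hf : SmoothFun f x) : ∀ᶠ y in 𝓝 x, DiffFun f y := by
  filter_upwards [(contMDiffAt_iff_contMDiffAt_nhds (n := 1) (by simp)).1
    (ContMDiffAt.of_le hf (by exact_mod_cast le_top))] with y hy using hy.mdifferentiableAt (by simp)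

theorem SmoothAt.diffAt (hX : SmoothAt X x) : DiffAt X x :=
  ContMDiffAt.mdifferentiableAt hX (by simp)

theorem SmoothAt.eventually_diffAt (hX : SmoothAt X x) : ∀ᶠ y in 𝓝 x, DiffAt X y := by
  filter_upwards [(contMDiffAt_iff_contMDiffAt_nhds (n := 1) (by simp)).1
    (ContMDiffAt.of_le hX (by exact_mod_cast le_top))] with y hy using hy.mdifferentiableAt (by simp)

theorem SmoothAt.add (hX : SmoothAt X x) (hY : SmoothAt Y x) :
    SmoothAt (fun y ↦ X y + Y y) x := ContMDiffAt.add_section hX hY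

theorem SmoothAt.sub (hX : SmoothAt X x) (hY : SmoothAt Y x) :
    SmoothAt (fun y ↦ X y - Y y) x := ContMDiffAt.sub_section hX hY

theorem SmoothAt.smul (hf : SmoothFun f x) (hX : SmoothAt X x) :
    SmoothAt (fun y ↦ f y • X y) x := ContMDiffAt.smul_section hf hX

theorem SmoothAt.sum {X : Fin 3 → Π x : M, TangentSpace 𝓘(ℝ, E3) x}
    (hX : ∀ k, SmoothAt (X k) x) : SmoothAt (fun y ↦ ∑ k, X k y) x :=
  ContMDiffAt.sum_section fun k _ ↦ hX k

theorem SmoothAt.congr (hX : SmoothAt X x) (h : Y =ᶠ[𝓝 x] X) : SmoothAt Y x :=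
  ContMDiffAt.congr_of_eventuallyEq hX (h.mono fun y hy ↦ by simp only [hy])

theorem SmoothAt.bracket (hX : SmoothAt X x) (hY : SmoothAt Y x) :
    SmoothAt (mlieBracket 𝓘(ℝ, E3) X Y) x := by
  have : IsManifold 𝓘(ℝ, E3) (((⊤ : ℕ∞) : WithTop ℕ∞) + 1) M := by
    simpa using (inferInstance : IsManifold 𝓘(ℝ, E3) ∞ M)
  have : IsManifold 𝓘(ℝ, E3) (minSmoothness ℝ 2) M := by
    simpa using (inferInstance : IsManifold 𝓘(ℝ, E3) 2 M)
  exact ContMDiffAt.mlieBracket_vectorField (m := ⊤) (n := ⊤) hX hY (by simp)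

theorem DiffAt.add (hX : DiffAt X x) (hY : DiffAt Y x) : DiffAt (fun y ↦ X y + Y y) x :=
  mdifferentiableAt_add_section hX hY

theorem DiffAt.smul (hf : DiffFun f x) (hX : DiffAt X x) : DiffAt (fun y ↦ f y • X y) x :=
  MDifferentiableAt.smul_section hf hX

theorem bracket_add_right (hY : DiffAt Y x) (hZ : DiffAt Z x) :
    mlieBracket 𝓘(ℝ, E3) X (fun y ↦ Y y + Z y) x
      = mlieBracket 𝓘(ℝ, E3) X Y x + mlieBracket 𝓘(ℝ, E3) X Z x :=
  mlieBracket_add_right hY hZ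

theorem bracket_add_left (hX : DiffAt X x) (hY : DiffAt Y x) :
    mlieBracket 𝓘(ℝ, E3) (fun y ↦ X y + Y y) Z x
      = mlieBracket 𝓘(ℝ, E3) X Z x + mlieBracket 𝓘(ℝ, E3) Y Z x :=
  mlieBracket_add_left hX hY

theorem bracket_smul_right (hf : DiffFun f x) (hY : DiffAt Y x) :
    mlieBracket 𝓘(ℝ, E3) X (fun y ↦ f y • Y y) x
      = along X f x • Y x + f x • mlieBracket 𝓘(ℝ, E3) X Y x :=
  mlieBracket_smul_right hf hY

theorem bracket_smul_left (hf : DiffFun f x) (hX : DiffAt X x) :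
    mlieBracket 𝓘(ℝ, E3) (fun y ↦ f y • X y) Y x
      = -along Y f x • X x + f x • mlieBracket 𝓘(ℝ, E3) X Y x :=
  mlieBracket_smul_left hf hX

theorem bracket_swap : mlieBracket 𝓘(ℝ, E3) X Y x = -mlieBracket 𝓘(ℝ, E3) Y X x :=
  mlieBracket_swap_apply

theorem jacobi (hX : SmoothAt X x) (hY : SmoothAt Y x) (hZ : SmoothAt Z x) :
    mlieBracket 𝓘(ℝ, E3) X (mlieBracket 𝓘(ℝ, E3) Y Z) x
      = mlieBracket 𝓘(ℝ, E3) (mlieBracket 𝓘(ℝ, E3) X Y) Z x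
        + mlieBracket 𝓘(ℝ, E3) Y (mlieBracket 𝓘(ℝ, E3) X Z) x := by
  have : IsManifold 𝓘(ℝ, E3) (minSmoothness ℝ 3) M := by
    simpa using (inferInstance : IsManifold 𝓘(ℝ, E3) 3 M)
  refine leibniz_identity_mlieBracket_apply ?_ ?_ ?_
  · exact hX.of_le (by simpa using two_le_infty)
  · exact hY.of_le (by simpa using two_le_infty)
  · exact hZ.of_le (by simpa using two_le_infty)

theorem along_add (hf : DiffFun f x) (hh : DiffFun h x) :
    along X (fun y ↦ f y + h y) x = along X f x + along X h x := by
  simp only [along]; rw [mvfderiv_fun_add hf hh]; rfl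

theorem along_mul (hf : DiffFun f x) (hh : DiffFun h x) :
    along X (fun y ↦ f y * h y) x = f x * along X h x + h x * along X f x := by
  simp only [along]; rw [mvfderiv_fun_mul hf hh]; rfl

theorem along_const (a : ℝ) : along X (fun _ ↦ a) x = 0 := by
  simp only [along]; rw [mvfderiv_const]; rfl

theorem mvfderiv_congr {F : Type*} [NormedAddCommGroup F] [NormedSpace ℝ F] {f h : M → F}
    (hfh : f =ᶠ[𝓝 x] h) : mvfderiv 𝓘(ℝ, E3) f x = mvfderiv 𝓘(ℝ, E3) h x := by
  have h1 : mfderiv 𝓘(ℝ, E3) 𝓘(ℝ, F) f x = mfderiv 𝓘(ℝ, E3) 𝓘(ℝ, F) h x := hfh.mfderiv_eq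
  ext v
  exact congrArg (fun L : E3 →L[ℝ] F ↦ L v) h1

theorem along_congr (hfh : f =ᶠ[𝓝 x] h) : along X f x = along X h x := by
  simp only [along, mvfderiv_congr hfh]

end FieldCalculus

theorem sgn_mul_self (r : ℕ) (k : Fin 3) : sgn r k * sgn r k = 1 := by
  unfold sgn; split_ifs
  · rw [← mul_pow]; norm_num
  · norm_num

theorem sgn_ne_zero (r : ℕ) (k : Fin 3) : sgn r k ≠ 0 := by
  intro h; simpa [h] using sgn_mul_self r k

/-! ### Orthonormal bases and the Levi-Civita connection. -/

section LeviCivita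

variable {M : Type*} [TopologicalSpace M] [ChartedSpace E3 M] [IsManifold 𝓘(ℝ, E3) ∞ M] {r : ℕ}

variable {X Y Z W : Π x : M, TangentSpace 𝓘(ℝ, E3) x} {f : M → ℝ} {x : M}

theorem exists_smoothAt (v : TangentSpace 𝓘(ℝ, E3) x) :
    ∃ X : Π x : M, TangentSpace 𝓘(ℝ, E3) x, SmoothAt X x ∧ X x = v :=
  ⟨FiberBundle.extend E3 v, FiberBundle.contMDiffAt_extend 𝓘(ℝ, E3) E3 v, by simp⟩

namespace PseudoMetric

variable (m : PseudoMetric M r)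

/-- The function `g(X, Y)`. -/
noncomputable def gf (X Y : Π x : M, TangentSpace 𝓘(ℝ, E3) x) (x : M) : ℝ := m.g x (X x) (Y x)

/-- An orthonormal basis of the tangent space at `x`. -/
def IsOrthonormal (x : M) (f : Fin 3 → TangentSpace 𝓘(ℝ, E3) x) : Prop :=
  ∀ i j, m.g x (f i) (f j) = if i = j then sgn r i else 0

/-- A smooth orthonormal frame near `x`. -/
structure IsFrameAt (e : Fin 3 → Π x : M, TangentSpace 𝓘(ℝ, E3) x) (x : M) : Prop where
  smooth : ∀ k, SmoothAt (e k) x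
  orthonormal : ∀ᶠ y in 𝓝 x, m.IsOrthonormal y fun k ↦ e k y

variable {m}

theorem gf_comm : m.gf X Y = m.gf Y X := funext fun x ↦ m.symm x _ _

theorem smoothFun_gf (hX : SmoothAt X x) (hY : SmoothAt Y x) : SmoothFun (m.gf X Y) x := by
  have := ContMDiffAt.clm_bundle_apply₂ (E₃ := Bundle.Trivial M ℝ) (m.smooth x) hX hY
  exact ((contMDiffAt_section (E := Bundle.Trivial M ℝ) _).1 this)

theorem diffFun_gf (hX : DiffAt X x) (hY : DiffAt Y x) : DiffFun (m.gf X Y) x := by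
  have := MDifferentiableAt.clm_bundle_apply₂ (E₃ := Bundle.Trivial M ℝ)
    ((m.smooth x).mdifferentiableAt (by simp)) hX hY
  exact ((mdifferentiableAt_section _ _).1 this)

theorem IsOrthonormal.linearIndependent {e : Fin 3 → TangentSpace 𝓘(ℝ, E3) x}
    (he : m.IsOrthonormal x e) : LinearIndependent ℝ e := by
  rw [Fintype.linearIndependent_iff]
  intro a ha k
  have h : m.g x (∑ i, a i • e i) (e k) = 0 := by rw [ha]; simp
  simpa [he _ _, sgn_ne_zero] using h

theorem IsOrthonormal.expand {e : Fin 3 → TangentSpace 𝓘(ℝ, E3) x} (he : m.IsOrthonormal x e)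
    (v : TangentSpace 𝓘(ℝ, E3) x) : v = ∑ k, (sgn r k * m.g x v (e k)) • e k := by
  have hdim : Fintype.card (Fin 3) = Module.finrank ℝ (TangentSpace 𝓘(ℝ, E3) x) := by
    change _ = Module.finrank ℝ E3; simp
  have hspan := he.linearIndependent.span_eq_top_of_card_eq_finrank hdim
  obtain ⟨a, rfl⟩ := (Submodule.mem_span_range_iff_exists_fun ℝ).1
    (hspan ▸ Submodule.mem_top : v ∈ Submodule.span ℝ (Set.range e))
  refine Finset.sum_congr rfl fun k _ ↦ ?_
  congr 1
  simp [he _ _, mul_left_comm _ (a k), sgn_mul_self]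

theorem IsOrthonormal.parseval {e : Fin 3 → TangentSpace 𝓘(ℝ, E3) x} (he : m.IsOrthonormal x e)
    (v w : TangentSpace 𝓘(ℝ, E3) x) :
    ∑ k, sgn r k * m.g x v (e k) * m.g x w (e k) = m.g x v w := by
  conv_rhs => rw [he.expand v]
  simp [m.symm x w]

theorem ext_g {v w : TangentSpace 𝓘(ℝ, E3) x} (h : ∀ z, m.g x v z = m.g x w z) : v = w := by
  obtain ⟨e, he⟩ := m.signature x
  have he : m.IsOrthonormal x e := he
  rw [he.expand v, he.expand w]
  simp [h]

/-- The trace of an endomorphism does not depend on the orthonormal basis. -/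
theorem IsOrthonormal.trace_eq {e f : Fin 3 → TangentSpace 𝓘(ℝ, E3) x} (he : m.IsOrthonormal x e)
    (hf : m.IsOrthonormal x f) (A : TangentSpace 𝓘(ℝ, E3) x →ₗ[ℝ] TangentSpace 𝓘(ℝ, E3) x) :
    ∑ k, sgn r k * m.g x (A (e k)) (e k) = ∑ k, sgn r k * m.g x (A (f k)) (f k) := by
  have h1 : ∀ k, sgn r k * m.g x (A (e k)) (e k)
      = ∑ j, sgn r k * (sgn r j * m.g x (e k) (f j)) * m.g x (A (f j)) (e k) := by
    intro k
    have h2 : A (e k) = ∑ j, (sgn r j * m.g x (e k) (f j)) • A (f j) := by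
      conv_lhs => rw [hf.expand (e k), map_sum]
      simp only [map_smul]
    rw [h2]
    simp [Finset.mul_sum, mul_assoc]
  simp_rw [h1]
  rw [Finset.sum_comm]
  refine Finset.sum_congr rfl fun j _ ↦ ?_
  -- After each `A (e k)` is expanded through the basis `f` and the sums are exchanged, the sum over
  -- `k` is Parseval's identity for `e`.
  rw [← he.parseval (A (f j)) (f j), Finset.mul_sum]
  refine Finset.sum_congr rfl fun k _ ↦ ?_
  rw [m.symm x (f j)]; ring

theorem koszul_def : m.koszul X Y Z x = along X (m.gf Y Z) x + along Y (m.gf X Z) x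
    - along Z (m.gf X Y) x + m.g x (mlieBracket 𝓘(ℝ, E3) X Y x) (Z x)
    - m.g x (mlieBracket 𝓘(ℝ, E3) X Z x) (Y x) - m.g x (mlieBracket 𝓘(ℝ, E3) Y Z x) (X x) := rfl

theorem gf_smul_left : m.gf (fun y ↦ f y • X y) Y = fun y ↦ f y * m.gf X Y y := by
  ext y; simp [gf]

theorem gf_smul_right : m.gf X (fun y ↦ f y • Y y) = fun y ↦ f y * m.gf X Y y := by
  ext y; simp [gf]

theorem gf_add_left : m.gf (fun y ↦ X y + Y y) Z = fun y ↦ m.gf X Z y + m.gf Y Z y := by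
  ext y; simp [gf]

theorem gf_add_right : m.gf X (fun y ↦ Y y + Z y) = fun y ↦ m.gf X Y y + m.gf X Z y := by
  ext y; simp [gf]

theorem along_add_field {f : M → ℝ} :
    along (fun y ↦ X y + Y y) f x = along X f x + along Y f x := by simp [along]

theorem along_smul_field {f h : M → ℝ} : along (fun y ↦ h y • X y) f x = h x * along X f x := by
  simp [along]

/-- In the two outer slots the derivatives of `f` coming from the metric terms cancel those coming
from the brackets. In the middle slot they add up to the Leibniz term of a connection. -/
theorem koszul_smul_left (hf : DiffFun f x) (hX : DiffAt X x) (hY : DiffAt Y x)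
    (hZ : DiffAt Z x) : m.koszul (fun y ↦ f y • X y) Y Z x = f x * m.koszul X Y Z x := by
  simp only [koszul_def, gf_smul_left, along_mul hf (diffFun_gf hX hY), along_smul_field,
    along_mul hf (diffFun_gf hX hZ), bracket_smul_left hf hX]
  simp only [gf, map_add, map_smul, map_neg, add_apply, smul_apply, neg_apply, neg_smul, smul_eq_mul]
  ring

theorem koszul_smul_right (hf : DiffFun f x) (hX : DiffAt X x) (hY : DiffAt Y x)
    (hZ : DiffAt Z x) : m.koszul X Y (fun y ↦ f y • Z y) x = f x * m.koszul X Y Z x := by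
  simp only [koszul_def, gf_smul_right, along_mul hf (diffFun_gf hX hZ), along_smul_field,
    along_mul hf (diffFun_gf hY hZ), bracket_smul_right hf hZ]
  simp only [gf, map_add, map_smul, add_apply, smul_apply, smul_eq_mul]
  rw [m.symm x (Y x) (Z x), m.symm x (X x) (Z x)]; ring

theorem koszul_smul_mid (hf : DiffFun f x) (hX : DiffAt X x) (hY : DiffAt Y x)
    (hZ : DiffAt Z x) : m.koszul X (fun y ↦ f y • Y y) Z x
      = f x * m.koszul X Y Z x + 2 * along X f x * m.g x (Y x) (Z x) := by
  simp only [koszul_def, gf_smul_right, gf_smul_left, along_mul hf (diffFun_gf hX hY),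
    along_smul_field, along_mul hf (diffFun_gf hY hZ), bracket_smul_right hf hY,
    bracket_smul_left hf hY]
  simp only [gf, map_add, map_smul, map_neg, add_apply, smul_apply, neg_apply, neg_smul, smul_eq_mul]
  rw [m.symm x (Y x) (X x)]; ring

theorem koszul_add_left (hX : DiffAt X x) (hW : DiffAt W x) (hY : DiffAt Y x) (hZ : DiffAt Z x) :
    m.koszul (fun y ↦ X y + W y) Y Z x = m.koszul X Y Z x + m.koszul W Y Z x := by
  simp only [koszul_def, gf_add_left, along_add (diffFun_gf hX hY) (diffFun_gf hW hY),
    along_add_field, along_add (diffFun_gf hX hZ) (diffFun_gf hW hZ), bracket_add_left hX hW]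
  simp
  ring

theorem koszul_add_right (hX : DiffAt X x) (hW : DiffAt W x) (hY : DiffAt Y x)
    (hZ : DiffAt Z x) :
    m.koszul X Y (fun y ↦ Z y + W y) x = m.koszul X Y Z x + m.koszul X Y W x := by
  simp only [koszul_def, gf_add_right, along_add (diffFun_gf hX hZ) (diffFun_gf hX hW),
    along_add_field, along_add (diffFun_gf hY hZ) (diffFun_gf hY hW), bracket_add_right hZ hW]
  simp
  ring

theorem koszul_add_mid (hX : DiffAt X x) (hW : DiffAt W x) (hY : DiffAt Y x)
    (hZ : DiffAt Z x) :
    m.koszul X (fun y ↦ Y y + W y) Z x = m.koszul X Y Z x + m.koszul X W Z x := by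
  simp only [koszul_def, gf_add_right, gf_add_left, along_add (diffFun_gf hX hY) (diffFun_gf hX hW),
    along_add_field, along_add (diffFun_gf hY hZ) (diffFun_gf hW hZ), bracket_add_right hY hW,
    bracket_add_left hY hW]
  simp
  ring

theorem koszul_congr_mid (h : Y =ᶠ[𝓝 x] W) : m.koszul X Y Z x = m.koszul X W Z x := by
  have h1 : m.gf Y Z =ᶠ[𝓝 x] m.gf W Z := h.mono fun y hy ↦ by simp [gf, hy]
  have h2 : m.gf X Y =ᶠ[𝓝 x] m.gf X W := h.mono fun y hy ↦ by simp [gf, hy]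
  rw [koszul_def, koszul_def, along_congr h1, along_congr h2,
    h.mlieBracket_vectorField_eq (EventuallyEq.refl (𝓝 x) Z),
    (EventuallyEq.refl (𝓝 x) X).mlieBracket_vectorField_eq h]
  simp only [along, h.self_of_nhds]

/-- Tensoriality in `X` and `Z` turns the Koszul expression into a bilinear form on the tangent
space, and the metric represents it by a vector. This makes the choice in `nabla` meaningful. -/
theorem exists_nabla (hY : DiffAt Y x) (v : TangentSpace 𝓘(ℝ, E3) x) :
    ∃ w, ∀ X Z : Π x : M, TangentSpace 𝓘(ℝ, E3) x,
      DiffAt X x → DiffAt Z x → X x = v → 2 * m.g x w (Z x) = m.koszul X Y Z x := by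
  have h1 : ∀ Z : Π x : M, TangentSpace 𝓘(ℝ, E3) x, DiffAt Z x →
      TensorialAt 𝓘(ℝ, E3) E3 (fun X : Π x : M, TangentSpace 𝓘(ℝ, E3) x ↦ m.koszul X Y Z x) x :=
    fun Z hZ ↦ ⟨fun hf hX ↦ koszul_smul_left hf hX hY hZ,
      fun hX hW ↦ koszul_add_left hX hW hY hZ⟩
  have h2 : ∀ X : Π x : M, TangentSpace 𝓘(ℝ, E3) x, DiffAt X x →
      TensorialAt 𝓘(ℝ, E3) E3 (fun Z : Π x : M, TangentSpace 𝓘(ℝ, E3) x ↦ m.koszul X Y Z x) x :=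
    fun X hX ↦ ⟨fun hf hZ ↦ koszul_smul_right hf hX hY hZ,
      fun hZ hW ↦ koszul_add_right hX hW hY hZ⟩
  obtain ⟨e, he⟩ := m.signature x
  have he : m.IsOrthonormal x e := he
  set B := TensorialAt.mkHom₂ (fun X Z ↦ m.koszul X Y Z x) x h1 h2 with hB
  refine ⟨∑ k, (sgn r k * B v (e k) / 2) • e k, ?_⟩
  rintro X Z hX hZ rfl
  rw [← TensorialAt.mkHom₂_apply (Φ := fun X Z ↦ m.koszul X Y Z x) h1 h2 hX hZ, ← hB]
  conv_rhs => rw [he.expand (Z x)]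
  simp only [map_sum, map_smul, sum_apply, smul_apply,
    smul_eq_mul, Finset.mul_sum, m.symm x (Z x)]
  refine Finset.sum_congr rfl fun k _ ↦ ?_
  ring

theorem nabla_spec (hX : DiffAt X x) (hY : DiffAt Y x) (hZ : DiffAt Z x) :
    2 * m.g x (m.nabla Y x (X x)) (Z x) = m.koszul X Y Z x :=
  Classical.epsilon_spec (exists_nabla (m := m) hY (X x)) X Z hX hZ rfl

/-- Uniqueness in the Koszul formula; the rules of the connection follow by checking the formula for
the expected right-hand side. -/
theorem eq_nabla (hX : DiffAt X x) (hY : DiffAt Y x) {w : TangentSpace 𝓘(ℝ, E3) x}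
    (h : ∀ Z : Π x : M, TangentSpace 𝓘(ℝ, E3) x, DiffAt Z x →
      2 * m.g x w (Z x) = m.koszul X Y Z x) : m.nabla Y x (X x) = w := by
  refine ext_g (m := m) fun z ↦ ?_
  obtain ⟨Z, hZ, rfl⟩ := exists_smoothAt z
  have h1 := nabla_spec (m := m) hX hY hZ.diffAt
  have h2 := h Z hZ.diffAt
  linarith

/-- The predicate under the choice operator sees `Y` only through the Koszul expression, so no
differentiability is needed. -/
theorem nabla_congr (h : Y =ᶠ[𝓝 x] W) : m.nabla Y x = m.nabla W x := by
  ext1 v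
  simp only [nabla, koszul_congr_mid h]

theorem nabla_add (hY : DiffAt Y x) (hW : DiffAt W x) (v : TangentSpace 𝓘(ℝ, E3) x) :
    m.nabla (fun y ↦ Y y + W y) x v = m.nabla Y x v + m.nabla W x v := by
  obtain ⟨X, hX, rfl⟩ := exists_smoothAt v
  refine eq_nabla hX.diffAt (hY.add hW) fun Z hZ ↦ ?_
  rw [koszul_add_mid hX.diffAt hW hY hZ, ← nabla_spec hX.diffAt hY hZ,
    ← nabla_spec hX.diffAt hW hZ]
  simp; ring

theorem nabla_smul (hf : DiffFun f x) (hX : DiffAt X x) (hY : DiffAt Y x) :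
    m.nabla (fun y ↦ f y • Y y) x (X x) = along X f x • Y x + f x • m.nabla Y x (X x) := by
  refine eq_nabla hX (hY.smul hf) fun Z hZ ↦ ?_
  rw [koszul_smul_mid hf hX hY hZ, ← nabla_spec hX hY hZ]
  simp; ring

theorem nabla_vec_add (hY : DiffAt Y x) (v w : TangentSpace 𝓘(ℝ, E3) x) :
    m.nabla Y x (v + w) = m.nabla Y x v + m.nabla Y x w := by
  obtain ⟨X, hX, rfl⟩ := exists_smoothAt v
  obtain ⟨W, hW, rfl⟩ := exists_smoothAt w
  refine eq_nabla (X := fun y ↦ X y + W y) (hX.add hW).diffAt hY fun Z hZ ↦ ?_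
  rw [koszul_add_left hX.diffAt hW.diffAt hY hZ, ← nabla_spec hX.diffAt hY hZ,
    ← nabla_spec hW.diffAt hY hZ]
  simp; ring

theorem nabla_vec_smul (hY : DiffAt Y x) (a : ℝ) (v : TangentSpace 𝓘(ℝ, E3) x) :
    m.nabla Y x (a • v) = a • m.nabla Y x v := by
  obtain ⟨X, hX, rfl⟩ := exists_smoothAt v
  refine eq_nabla (X := fun y ↦ a • X y) ((SmoothAt.smul (SmoothFun.const a) hX).diffAt) hY
    fun Z hZ ↦ ?_
  rw [koszul_smul_left (SmoothFun.const a).diffFun hX.diffAt hY hZ, ← nabla_spec hX.diffAt hY hZ]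
  simp; ring

theorem nabla_sub (hY : DiffAt Y x) (hW : DiffAt W x) (v : TangentSpace 𝓘(ℝ, E3) x) :
    m.nabla (fun y ↦ Y y - W y) x v = m.nabla Y x v - m.nabla W x v := by
  have hd : DiffAt (fun y ↦ Y y - W y) x := by
    exact (mdifferentiableAt_sub_section hY hW)
  have := nabla_add (m := m) hd hW v
  simp only [sub_add_cancel] at this
  rw [this, add_sub_cancel_right]

/-- The Levi-Civita connection is metric. -/
theorem nabla_metric (hX : DiffAt X x) (hY : DiffAt Y x) (hZ : DiffAt Z x) :
    along X (m.gf Y Z) x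
      = m.g x (m.nabla Y x (X x)) (Z x) + m.g x (m.nabla Z x (X x)) (Y x) := by
  have h1 := nabla_spec (m := m) hX hY hZ
  have h2 := nabla_spec (m := m) hX hZ hY
  rw [koszul_def] at h1 h2
  rw [gf_comm (X := Z), bracket_swap (X := Z)] at h2
  simp only [map_neg, neg_apply] at h2
  linarith

/-- The Levi-Civita connection is torsion-free. -/
theorem nabla_torsion (hX : DiffAt X x) (hY : DiffAt Y x) :
    m.nabla Y x (X x) - m.nabla X x (Y x) = mlieBracket 𝓘(ℝ, E3) X Y x := by
  refine ext_g (m := m) fun z ↦ ?_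
  obtain ⟨Z, hZ, rfl⟩ := exists_smoothAt z
  have h1 := nabla_spec (m := m) hX hY hZ.diffAt
  have h2 := nabla_spec (m := m) hY hX hZ.diffAt
  rw [koszul_def] at h1 h2
  rw [gf_comm (X := Y) (Y := X), bracket_swap (X := Y)] at h2
  simp only [map_neg, map_sub, neg_apply, sub_apply]
    at h2 ⊢
  linarith

end PseudoMetric

end LeviCivita

/-! ### The curvature tensor: tensoriality and symmetries. -/

section Curvature

variable {M : Type*} [TopologicalSpace M] [ChartedSpace E3 M] [IsManifold 𝓘(ℝ, E3) ∞ M] {r : ℕ}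

variable {X Y Z W : Π x : M, TangentSpace 𝓘(ℝ, E3) x} {f : M → ℝ} {x : M}

namespace PseudoMetric

variable {m : PseudoMetric M r}

/-- Pairing with such a field `Z` extracts the coefficient of a multiple of `Z`. The basis vector of
index `1` is spacelike in both signatures. -/
theorem exists_smoothAt_gf_eq_one (m : PseudoMetric M r) (x : M) :
    ∃ Z : Π x : M, TangentSpace 𝓘(ℝ, E3) x, SmoothAt Z x ∧ m.gf Z Z x = 1 := by
  obtain ⟨e, he⟩ := m.signature x
  obtain ⟨Z, hZ, hZe⟩ := exists_smoothAt (e 1)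
  exact ⟨Z, hZ, by simp [gf, hZe, he, sgn]⟩

/-- Smoothness is inherited from Lie brackets: `[X, fZ] - f[X, Z] = X(f) Z`, so `X(f)` is a quotient
of smooth scalar products near `x`. -/
theorem smoothFun_along (m : PseudoMetric M r) (hX : SmoothAt X x) (hf : SmoothFun f x) :
    SmoothFun (along X f) x := by
  obtain ⟨Z, hZ, h1⟩ := m.exists_smoothAt_gf_eq_one x
  have hgZ := smoothFun_gf (m := m) hZ hZ
  have hW := (hX.bracket (hZ.smul hf)).sub ((hX.bracket hZ).smul hf)
  have hq : SmoothFun (fun y ↦ m.gf (fun y ↦ mlieBracket 𝓘(ℝ, E3) X (fun y ↦ f y • Z y) y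
      - f y • mlieBracket 𝓘(ℝ, E3) X Z y) Z y / m.gf Z Z y) x :=
    ContMDiffAt.div₀ (smoothFun_gf hW hZ) hgZ (by simp [h1])
  refine hq.congr ?_
  have hne : ∀ᶠ y in 𝓝 x, m.gf Z Z y ≠ 0 :=
    (ContMDiffAt.continuousAt hgZ).eventually_ne (by simp [h1])
  filter_upwards [hne, hf.eventually_diffFun, hZ.eventually_diffAt] with y hy hfy hZy
  rw [eq_div_iff hy]
  simp [gf, bracket_smul_right hfy hZy]

/-- The Lie bracket is the commutator of derivations. -/
theorem along_bracket (m : PseudoMetric M r) (hX : SmoothAt X x) (hY : SmoothAt Y x)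
    (hf : SmoothFun f x) :
    along (mlieBracket 𝓘(ℝ, E3) X Y) f x = along X (along Y f) x - along Y (along X f) x := by
  obtain ⟨Z, hZ, h1⟩ := m.exists_smoothAt_gf_eq_one x
  have key : ∀ {X Y : Π x : M, TangentSpace 𝓘(ℝ, E3) x}, SmoothAt X x → SmoothAt Y x →
      mlieBracket 𝓘(ℝ, E3) X (mlieBracket 𝓘(ℝ, E3) Y (fun y ↦ f y • Z y)) x
        = (along X (along Y f) x • Z x + along Y f x • mlieBracket 𝓘(ℝ, E3) X Z x)
          + (along X f x • mlieBracket 𝓘(ℝ, E3) Y Z x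
            + f x • mlieBracket 𝓘(ℝ, E3) X (mlieBracket 𝓘(ℝ, E3) Y Z) x) := by
    intro X Y hX hY
    have h : mlieBracket 𝓘(ℝ, E3) Y (fun y ↦ f y • Z y)
        =ᶠ[𝓝 x] fun y ↦ along Y f y • Z y + f y • mlieBracket 𝓘(ℝ, E3) Y Z y := by
      filter_upwards [hf.eventually_diffFun, hZ.eventually_diffAt] with y hfy hZy
      exact bracket_smul_right hfy hZy
    have hYf := m.smoothFun_along hY hf
    rw [(EventuallyEq.refl (𝓝 x) X).mlieBracket_vectorField_eq h,
      bracket_add_right (hZ.smul hYf).diffAt ((hY.bracket hZ).smul hf).diffAt,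
      bracket_smul_right hYf.diffFun hZ.diffAt,
      bracket_smul_right hf.diffFun (hY.bracket hZ).diffAt]
  -- The Jacobi identities for `X, Y, fZ` and for `X, Y, Z` differ by a multiple of `Z`, whose
  -- coefficient is the desired identity.
  have hJ := jacobi hX hY (hZ.smul hf)
  have hJ' := jacobi hX hY hZ
  rw [key hX hY, key hY hX, bracket_smul_right hf.diffFun hZ.diffAt, hJ'] at hJ
  have h2 := congrArg (fun v ↦ m.g x v (Z x)) hJ
  simp only [map_add, map_smul, add_apply, smul_apply, smul_eq_mul] at h2
  rw [show m.g x (Z x) (Z x) = 1 from h1] at h2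
  linarith

theorem koszul_smooth (hX : SmoothAt X x) (hY : SmoothAt Y x) (hZ : SmoothAt Z x) :
    SmoothFun (m.koszul X Y Z) x :=
  (((((m.smoothFun_along hX (smoothFun_gf hY hZ)).add
    (m.smoothFun_along hY (smoothFun_gf hX hZ))).sub
    (m.smoothFun_along hZ (smoothFun_gf hX hY))).add
    (smoothFun_gf (m := m) (hX.bracket hY) hZ)).sub
    (smoothFun_gf (m := m) (hX.bracket hZ) hY)).sub
    (smoothFun_gf (m := m) (hY.bracket hZ) hX)

variable (m) in
/-- The vector field `∇_X Y`. -/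
noncomputable def cov (X Y : Π x : M, TangentSpace 𝓘(ℝ, E3) x) (x : M) :
    TangentSpace 𝓘(ℝ, E3) x := m.nabla Y x (X x)

variable {e : Fin 3 → Π x : M, TangentSpace 𝓘(ℝ, E3) x}

/-- The frame components of `∇_X Y` are, up to constants, Koszul expressions, which are smooth. -/
theorem IsFrameAt.cov_smooth (he : m.IsFrameAt e x) (hX : SmoothAt X x) (hY : SmoothAt Y x) :
    SmoothAt (m.cov X Y) x := by
  refine SmoothAt.congr (SmoothAt.sum fun k ↦ SmoothAt.smul
    ((SmoothFun.const (sgn r k / 2)).mul (koszul_smooth (m := m) hX hY (he.smooth k)))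
    (he.smooth k)) ?_
  filter_upwards [he.orthonormal, hX.eventually_diffAt, hY.eventually_diffAt,
    (he.smooth 0).eventually_diffAt, (he.smooth 1).eventually_diffAt,
    (he.smooth 2).eventually_diffAt] with y hy hXy hYy h0 h1 h2
  have hk : ∀ k, DiffAt (e k) y := by intro k; fin_cases k <;> assumption
  rw [hy.expand (m.cov X Y y)]
  refine Finset.sum_congr rfl fun k _ ↦ ?_
  rw [← nabla_spec hXy hYy (hk k)]
  congr 1
  simp only [cov]; ring

theorem curv_def : m.curv X Y Z x = m.cov X (m.cov Y Z) x - m.cov Y (m.cov X Z) x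
    - m.nabla Z x (mlieBracket 𝓘(ℝ, E3) X Y x) := rfl

theorem cov_congr (h : Y =ᶠ[𝓝 x] Z) : m.cov X Y x = m.cov X Z x := by
  simp only [cov, nabla_congr h]

theorem cov_congr_left (h : X x = W x) : m.cov X Y x = m.cov W Y x := by
  simp only [cov, h]

theorem curv_congr {X' Y' Z' : Π x : M, TangentSpace 𝓘(ℝ, E3) x} (hX : X =ᶠ[𝓝 x] X')
    (hY : Y =ᶠ[𝓝 x] Y') (hZ : Z =ᶠ[𝓝 x] Z') : m.curv X Y Z x = m.curv X' Y' Z' x := by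
  have h : ∀ {Y Y' : Π x : M, TangentSpace 𝓘(ℝ, E3) x}, Y =ᶠ[𝓝 x] Y' →
      m.cov Y Z =ᶠ[𝓝 x] m.cov Y' Z' := by
    intro Y Y' hY
    filter_upwards [hY, hZ.eventuallyEq_nhds] with y h1 h2
    rw [cov_congr h2, cov_congr_left h1]
  rw [curv_def, curv_def, cov_congr (h hY), cov_congr (h hX), cov_congr_left hX.self_of_nhds,
    cov_congr_left hY.self_of_nhds, hX.mlieBracket_vectorField_eq hY, nabla_congr hZ]

theorem IsFrameAt.curv_swap (_he : m.IsFrameAt e x) (hZ : SmoothAt Z x) :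
    m.curv X Y Z x = -m.curv Y X Z x := by
  have h : m.nabla Z x (mlieBracket 𝓘(ℝ, E3) X Y x)
      = -m.nabla Z x (mlieBracket 𝓘(ℝ, E3) Y X x) := by
    rw [bracket_swap, ← neg_one_smul ℝ, nabla_vec_smul hZ.diffAt, neg_one_smul]
  rw [curv_def, curv_def, h]
  abel

theorem IsFrameAt.curv_add (he : m.IsFrameAt e x) (hX : SmoothAt X x) (hY : SmoothAt Y x)
    (hZ : SmoothAt Z x) (hW : SmoothAt W x) :
    m.curv X Y (fun y ↦ Z y + W y) x = m.curv X Y Z x + m.curv X Y W x := by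
  have h : ∀ {X Y : Π x : M, TangentSpace 𝓘(ℝ, E3) x}, SmoothAt X x → SmoothAt Y x →
      m.cov X (m.cov Y fun y ↦ Z y + W y) x
        = m.cov X (m.cov Y Z) x + m.cov X (m.cov Y W) x := by
    intro X Y hX hY
    have h1 : m.cov Y (fun y ↦ Z y + W y) =ᶠ[𝓝 x] fun y ↦ m.cov Y Z y + m.cov Y W y := by
      filter_upwards [hZ.eventually_diffAt, hW.eventually_diffAt] with y hZy hWy
      exact nabla_add hZy hWy _
    rw [cov_congr h1]
    exact nabla_add (he.cov_smooth hY hZ).diffAt (he.cov_smooth hY hW).diffAt _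
  rw [curv_def, h hX hY, h hY hX, nabla_add hZ.diffAt hW.diffAt, curv_def, curv_def]
  abel

/-- The mixed first-order terms are symmetric in `X` and `Y`, and the second derivatives of `f` are
absorbed by `∇_[X,Y]` through `along_bracket`. -/
theorem IsFrameAt.curv_smul (he : m.IsFrameAt e x) (hX : SmoothAt X x) (hY : SmoothAt Y x)
    (hZ : SmoothAt Z x) (hf : SmoothFun f x) :
    m.curv X Y (fun y ↦ f y • Z y) x = f x • m.curv X Y Z x := by
  have h : ∀ {X Y : Π x : M, TangentSpace 𝓘(ℝ, E3) x}, SmoothAt X x → SmoothAt Y x →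
      m.cov X (m.cov Y fun y ↦ f y • Z y) x
        = (along X (along Y f) x • Z x + along Y f x • m.cov X Z x)
          + (along X f x • m.cov Y Z x + f x • m.cov X (m.cov Y Z) x) := by
    intro X Y hX hY
    have h1 : m.cov Y (fun y ↦ f y • Z y)
        =ᶠ[𝓝 x] fun y ↦ along Y f y • Z y + f y • m.cov Y Z y := by
      filter_upwards [hZ.eventually_diffAt, hY.eventually_diffAt, hf.eventually_diffFun]
        with y hZy hYy hfy
      exact nabla_smul hfy hYy hZy
    have hYf := m.smoothFun_along hY hf
    have hYZ := he.cov_smooth hY hZ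
    rw [cov_congr h1, cov, nabla_add (hZ.smul hYf).diffAt (hYZ.smul hf).diffAt,
      nabla_smul hYf.diffFun hX.diffAt hZ.diffAt, nabla_smul hf.diffFun hX.diffAt hYZ.diffAt]
    rfl
  rw [curv_def, h hX hY, h hY hX, nabla_smul hf.diffFun (hX.bracket hY).diffAt hZ.diffAt,
    m.along_bracket hX hY hf, curv_def]
  module

theorem IsFrameAt.curv_add_left (he : m.IsFrameAt e x) (hX : SmoothAt X x) (hW : SmoothAt W x)
    (hY : SmoothAt Y x) (hZ : SmoothAt Z x) :
    m.curv (fun y ↦ X y + W y) Y Z x = m.curv X Y Z x + m.curv W Y Z x := by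
  have h1 : m.cov (fun y ↦ X y + W y) Z =ᶠ[𝓝 x] fun y ↦ m.cov X Z y + m.cov W Z y := by
    filter_upwards [hZ.eventually_diffAt] with y hZy
    exact nabla_vec_add hZy _ _
  rw [curv_def, cov_congr h1, bracket_add_left hX.diffAt hW.diffAt, nabla_vec_add hZ.diffAt]
  simp only [curv_def]
  rw [cov, nabla_vec_add (he.cov_smooth hY hZ).diffAt, cov, nabla_add
    (he.cov_smooth hX hZ).diffAt (he.cov_smooth hW hZ).diffAt]
  simp only [cov]
  abel

theorem IsFrameAt.curv_smul_left (he : m.IsFrameAt e x) (hX : SmoothAt X x)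
    (hY : SmoothAt Y x) (hZ : SmoothAt Z x) (hf : SmoothFun f x) :
    m.curv (fun y ↦ f y • X y) Y Z x = f x • m.curv X Y Z x := by
  have h1 : m.cov (fun y ↦ f y • X y) Z =ᶠ[𝓝 x] fun y ↦ f y • m.cov X Z y := by
    filter_upwards [hZ.eventually_diffAt] with y hZy
    exact nabla_vec_smul hZy _ _
  rw [curv_def, cov_congr h1, bracket_smul_left hf.diffFun hX.diffAt, nabla_vec_add hZ.diffAt,
    nabla_vec_smul hZ.diffAt, nabla_vec_smul hZ.diffAt]
  rw [cov, nabla_vec_smul (he.cov_smooth hY hZ).diffAt, cov, nabla_smul hf.diffFun hY.diffAt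
    (he.cov_smooth hX hZ).diffAt]
  simp only [curv_def, cov]
  module

/-- The curvature operators are skew-adjoint. -/
theorem IsFrameAt.curv_skew (he : m.IsFrameAt e x) (hX : SmoothAt X x) (hY : SmoothAt Y x)
    (hZ : SmoothAt Z x) (hW : SmoothAt W x) :
    m.g x (m.curv X Y Z x) (W x) = -m.g x (m.curv X Y W x) (Z x) := by
  have h : ∀ {X Y : Π x : M, TangentSpace 𝓘(ℝ, E3) x}, SmoothAt X x → SmoothAt Y x →
      along X (along Y (m.gf Z W)) x
        = (m.g x (m.cov X (m.cov Y Z) x) (W x) + m.g x (m.cov X W x) (m.cov Y Z x))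
          + (m.g x (m.cov X (m.cov Y W) x) (Z x) + m.g x (m.cov X Z x) (m.cov Y W x)) := by
    intro X Y hX hY
    have h1 : along Y (m.gf Z W)
        =ᶠ[𝓝 x] fun y ↦ m.gf (m.cov Y Z) W y + m.gf (m.cov Y W) Z y := by
      filter_upwards [hZ.eventually_diffAt, hY.eventually_diffAt, hW.eventually_diffAt]
        with y hZy hYy hWy
      exact nabla_metric hYy hZy hWy
    have hYZ := (he.cov_smooth hY hZ).diffAt
    have hYW := (he.cov_smooth hY hW).diffAt
    rw [along_congr h1, along_add (diffFun_gf hYZ hW.diffAt) (diffFun_gf hYW hZ.diffAt),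
      nabla_metric hX.diffAt hYZ hW.diffAt, nabla_metric hX.diffAt hYW hZ.diffAt]
    rfl
  -- The commutator of `X` and `Y` applied to `g(Z,W)`, computed by metric compatibility; the
  -- products of first derivatives cancel.
  have h2 := m.along_bracket hX hY (smoothFun_gf (m := m) hZ hW)
  rw [h hX hY, h hY hX, nabla_metric (hX.bracket hY).diffAt hZ.diffAt hW.diffAt,
    m.symm x (m.cov X W x), m.symm x (m.cov X Z x)] at h2
  simp only [curv_def, map_sub, sub_apply]
  linarith

/-- The first Bianchi identity. -/
theorem IsFrameAt.bianchi (he : m.IsFrameAt e x) (hX : SmoothAt X x) (hY : SmoothAt Y x)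
    (hZ : SmoothAt Z x) :
    m.curv X Y Z x + m.curv Y Z X x + m.curv Z X Y x = 0 := by
  have h : ∀ {X Y Z : Π x : M, TangentSpace 𝓘(ℝ, E3) x}, SmoothAt X x → SmoothAt Y x →
      SmoothAt Z x → m.cov X (m.cov Y Z) x - m.cov X (m.cov Z Y) x
        - m.nabla X x (mlieBracket 𝓘(ℝ, E3) Y Z x)
        = mlieBracket 𝓘(ℝ, E3) X (mlieBracket 𝓘(ℝ, E3) Y Z) x := by
    intro X Y Z hX hY hZ
    have h1 : (fun y ↦ m.cov Y Z y - m.cov Z Y y) =ᶠ[𝓝 x] mlieBracket 𝓘(ℝ, E3) Y Z := by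
      filter_upwards [hZ.eventually_diffAt, hY.eventually_diffAt] with y hZy hYy
      exact nabla_torsion hYy hZy
    have h2 := nabla_sub (m := m) (he.cov_smooth hY hZ).diffAt (he.cov_smooth hZ hY).diffAt (X x)
    rw [nabla_congr h1] at h2
    rw [← nabla_torsion (m := m) hX.diffAt (hY.bracket hZ).diffAt, h2]
    rfl
  -- By vanishing torsion each iterated bracket is a combination of second covariant derivatives,
  -- and the Bianchi sum is then the Jacobi identity.
  have hJ := jacobi hX hY hZ
  rw [← h hX hY hZ, bracket_swap (X := mlieBracket 𝓘(ℝ, E3) X Y), ← h hZ hX hY,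
    ← h hY hX hZ] at hJ
  have hs : m.nabla Y x (mlieBracket 𝓘(ℝ, E3) X Z x)
      = -m.nabla Y x (mlieBracket 𝓘(ℝ, E3) Z X x) := by
    rw [bracket_swap, ← neg_one_smul ℝ, nabla_vec_smul hY.diffAt, neg_one_smul]
  rw [hs] at hJ
  have hJ' := sub_eq_zero.2 hJ
  rw [← hJ']
  simp only [curv_def]
  abel

theorem IsFrameAt.eventually_expand (he : m.IsFrameAt e x) :
    X =ᶠ[𝓝 x] fun y ↦ ∑ k, (sgn r k * m.gf X (e k) y) • e k y :=
  he.orthonormal.mono fun _ hy ↦ hy.expand _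

theorem IsFrameAt.coeff_smooth (he : m.IsFrameAt e x) (hX : SmoothAt X x) (k : Fin 3) :
    SmoothFun (fun y ↦ sgn r k * m.gf X (e k) y) x :=
  (SmoothFun.const _).mul (smoothFun_gf hX (he.smooth k))

theorem IsFrameAt.curv_expand (he : m.IsFrameAt e x) (hX : SmoothAt X x) (hY : SmoothAt Y x)
    (hZ : SmoothAt Z x) :
    m.curv X Y Z x = ∑ k, (sgn r k * m.g x (Z x) (e k x)) • m.curv X Y (e k) x := by
  have hk := fun k ↦ (he.smooth k).smul (he.coeff_smooth hZ k)
  have h1 : Z =ᶠ[𝓝 x] fun y ↦ (sgn r 0 * m.gf Z (e 0) y) • e 0 y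
      + (sgn r 1 * m.gf Z (e 1) y) • e 1 y + (sgn r 2 * m.gf Z (e 2) y) • e 2 y :=
    he.eventually_expand.trans (Eventually.of_forall fun y ↦ Fin.sum_univ_three _)
  refine Eq.trans ?_ (Fin.sum_univ_three _).symm
  rw [curv_congr (m := m) (.refl _ X) (.refl _ Y) h1, he.curv_add hX hY ((hk 0).add (hk 1)) (hk 2),
    he.curv_add hX hY (hk 0) (hk 1)]
  simp only [he.curv_smul hX hY (he.smooth _) (he.coeff_smooth hZ _)]
  rfl

theorem IsFrameAt.curv_expand_left (he : m.IsFrameAt e x) (hX : SmoothAt X x)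
    (hY : SmoothAt Y x) (hZ : SmoothAt Z x) :
    m.curv X Y Z x = ∑ k, (sgn r k * m.g x (X x) (e k x)) • m.curv (e k) Y Z x := by
  have hk := fun k ↦ (he.smooth k).smul (he.coeff_smooth hX k)
  have h1 : X =ᶠ[𝓝 x] fun y ↦ (sgn r 0 * m.gf X (e 0) y) • e 0 y
      + (sgn r 1 * m.gf X (e 1) y) • e 1 y + (sgn r 2 * m.gf X (e 2) y) • e 2 y :=
    he.eventually_expand.trans (Eventually.of_forall fun y ↦ Fin.sum_univ_three _)
  refine Eq.trans ?_ (Fin.sum_univ_three _).symm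
  rw [curv_congr (m := m) h1 (.refl _ Y) (.refl _ Z), he.curv_add_left ((hk 0).add (hk 1)) (hk 2) hY hZ,
    he.curv_add_left (hk 0) (hk 1) hY hZ]
  simp only [he.curv_smul_left (he.smooth _) hY hZ (he.coeff_smooth hX _)]
  rfl

/-- Linearity over functions and expansion in a frame near `x` leave only the values at `x`; this
makes `riem` an honest tensor. -/
theorem IsFrameAt.curv_pointwise (he : m.IsFrameAt e x)
    {X' Y' Z' : Π x : M, TangentSpace 𝓘(ℝ, E3) x} (hX : SmoothAt X x) (hY : SmoothAt Y x)
    (hZ : SmoothAt Z x) (hX' : SmoothAt X' x) (hY' : SmoothAt Y' x) (hZ' : SmoothAt Z' x)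
    (hXX : X x = X' x) (hYY : Y x = Y' x) (hZZ : Z x = Z' x) :
    m.curv X Y Z x = m.curv X' Y' Z' x := by
  have hl : ∀ {X X' Y Z : Π x : M, TangentSpace 𝓘(ℝ, E3) x}, SmoothAt X x → SmoothAt X' x →
      SmoothAt Y x → SmoothAt Z x → X x = X' x → m.curv X Y Z x = m.curv X' Y Z x := by
    intro X X' Y Z hX hX' hY hZ h
    rw [he.curv_expand_left hX hY hZ, he.curv_expand_left hX' hY hZ, h]
  rw [hl hX hX' hY hZ hXX, he.curv_swap hZ, hl hY hY' hX' hZ hYY, ← he.curv_swap hZ,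
    he.curv_expand hX' hY' hZ, he.curv_expand hX' hY' hZ', hZZ]

variable (m) in
/-- The curvature tensor at `x`, as a function of three tangent vectors. -/
noncomputable def riem (x : M) (u v w : TangentSpace 𝓘(ℝ, E3) x) : TangentSpace 𝓘(ℝ, E3) x :=
  m.curv (FiberBundle.extend E3 u) (FiberBundle.extend E3 v) (FiberBundle.extend E3 w) x

theorem smoothAt_extend (v : TangentSpace 𝓘(ℝ, E3) x) :
    SmoothAt (FiberBundle.extend E3 v : Π x : M, TangentSpace 𝓘(ℝ, E3) x) x :=
  FiberBundle.contMDiffAt_extend 𝓘(ℝ, E3) E3 v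

theorem IsFrameAt.riem_apply (he : m.IsFrameAt e x) (hX : SmoothAt X x) (hY : SmoothAt Y x)
    (hZ : SmoothAt Z x) : m.riem x (X x) (Y x) (Z x) = m.curv X Y Z x :=
  he.curv_pointwise (smoothAt_extend _) (smoothAt_extend _) (smoothAt_extend _) hX hY hZ
    (by simp) (by simp) (by simp)

variable (u u' v v' w w' : TangentSpace 𝓘(ℝ, E3) x) (a : ℝ)

theorem IsFrameAt.riem_swap (he : m.IsFrameAt e x) : m.riem x u v w = -m.riem x v u w :=
  he.curv_swap (smoothAt_extend _)

theorem IsFrameAt.riem_skew (he : m.IsFrameAt e x) :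
    m.g x (m.riem x u v w) w' = -m.g x (m.riem x u v w') w := by
  simpa [riem] using he.curv_skew (smoothAt_extend u) (smoothAt_extend v) (smoothAt_extend w)
    (smoothAt_extend w')

theorem IsFrameAt.riem_bianchi (he : m.IsFrameAt e x) :
    m.riem x u v w + m.riem x v w u + m.riem x w u v = 0 :=
  he.bianchi (smoothAt_extend u) (smoothAt_extend v) (smoothAt_extend w)

theorem IsFrameAt.riem_add_left (he : m.IsFrameAt e x) :
    m.riem x (u + u') v w = m.riem x u v w + m.riem x u' v w := by
  have hv := smoothAt_extend v
  have hw := smoothAt_extend w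
  have h := he.riem_apply ((smoothAt_extend u).add (smoothAt_extend u')) hv hw
  rw [he.curv_add_left (smoothAt_extend _) (smoothAt_extend _) hv hw] at h
  simpa [riem] using h

theorem IsFrameAt.riem_smul_left (he : m.IsFrameAt e x) :
    m.riem x (a • u) v w = a • m.riem x u v w := by
  have hv := smoothAt_extend v
  have hw := smoothAt_extend w
  have h := he.riem_apply ((smoothAt_extend u).smul (SmoothFun.const a)) hv hw
  rw [he.curv_smul_left (smoothAt_extend _) hv hw (SmoothFun.const a)] at h
  simpa [riem] using h

theorem IsFrameAt.riem_add_mid (he : m.IsFrameAt e x) :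
    m.riem x u (v + v') w = m.riem x u v w + m.riem x u v' w := by
  rw [he.riem_swap, he.riem_add_left, he.riem_swap v, he.riem_swap v']; abel

theorem IsFrameAt.riem_smul_mid (he : m.IsFrameAt e x) :
    m.riem x u (a • v) w = a • m.riem x u v w := by
  rw [he.riem_swap, he.riem_smul_left, he.riem_swap v, smul_neg, neg_neg]

theorem IsFrameAt.riem_add (he : m.IsFrameAt e x) :
    m.riem x u v (w + w') = m.riem x u v w + m.riem x u v w' := by
  have hu := smoothAt_extend u
  have hv := smoothAt_extend v
  have h := he.riem_apply hu hv ((smoothAt_extend w).add (smoothAt_extend w'))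
  rw [he.curv_add hu hv (smoothAt_extend _) (smoothAt_extend _)] at h
  simpa [riem] using h

theorem IsFrameAt.riem_smul (he : m.IsFrameAt e x) :
    m.riem x u v (a • w) = a • m.riem x u v w := by
  have hu := smoothAt_extend u
  have hv := smoothAt_extend v
  have h := he.riem_apply hu hv ((smoothAt_extend w).smul (SmoothFun.const a))
  rw [he.curv_smul hu hv (smoothAt_extend _) (SmoothFun.const a)] at h
  simpa [riem] using h

end PseudoMetric

end Curvature

theorem neg_one_pow_mul_self (r : ℕ) : ((-1 : ℝ) ^ r) * (-1) ^ r = 1 := by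
  rw [← mul_pow]; norm_num

/-! ### Ricci and scalar curvature of a Sasakian space-form. -/

section Sasakian

variable {M : Type*} [TopologicalSpace M] [ChartedSpace E3 M] [IsManifold 𝓘(ℝ, E3) ∞ M] {r : ℕ}

namespace ContactMetric

variable {c : ContactMetric M r} {x : M}

/-- From `φ²ξ = 0` one gets `φ³ξ = 0`, which forces `φξ = aξ`; then `a²ξ = φ²ξ = 0`. -/
theorem phi_xi (c : ContactMetric M r) (x : M) : c.phi x (c.xi x) = 0 := by
  have h1 : c.phi x (c.phi x (c.xi x)) = 0 := by rw [c.phi_phi, c.eta_xi]; simp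
  have h2 := c.phi_phi x (c.phi x (c.xi x))
  rw [h1, map_zero] at h2
  have h3 : c.phi x (c.xi x) = c.eta x (c.phi x (c.xi x)) • c.xi x := by
    rw [eq_comm, neg_add_eq_zero] at h2; exact h2
  generalize c.eta x (c.phi x (c.xi x)) = a at h3
  rw [h3, map_smul, h3, smul_smul] at h1
  have h4 := congrArg (c.eta x) h1
  rw [map_smul, c.eta_xi, map_zero, smul_eq_mul, mul_one, mul_self_eq_zero] at h4
  rw [h3, h4, zero_smul]

theorem g_xi (c : ContactMetric M r) (x : M) (v : TangentSpace 𝓘(ℝ, E3) x) :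
    c.g x (c.xi x) v = (-1) ^ r * c.eta x v := by
  have h := c.g_phi_phi x (c.xi x) v
  rw [c.phi_xi, map_zero, c.eta_xi] at h
  simp only [zero_apply] at h
  linarith

theorem eta_phi (c : ContactMetric M r) (x : M) (v : TangentSpace 𝓘(ℝ, E3) x) :
    c.eta x (c.phi x v) = 0 := by
  have h1 := c.phi_phi x (c.phi x v)
  rw [c.phi_phi x v, map_add, map_smul, c.phi_xi, map_neg, smul_zero, add_zero,
    left_eq_add] at h1
  have h2 := congrArg (c.eta x) h1
  simpa [c.eta_xi] using h2

theorem sum_eta_sq {e : Fin 3 → TangentSpace 𝓘(ℝ, E3) x}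
    (he : c.toPseudoMetric.IsOrthonormal x e) :
    ∑ k, sgn r k * (c.eta x (e k) * c.eta x (e k)) = (-1) ^ r := by
  have h := he.parseval (c.xi x) (c.xi x)
  simp only [c.g_xi, c.eta_xi, mul_one] at h
  rw [← h]
  refine Finset.sum_congr rfl fun k _ ↦ ?_
  linear_combination (-(sgn r k * (c.eta x (e k) * c.eta x (e k)))) * neg_one_pow_mul_self r

/-- Project an orthonormal basis to `ker η` along `ξ`. The squared lengths are `sgn r k - ε
η(e_k)²`; they cannot all be nonpositive, since `∑ sgn r k η(e_k)² = ε`. -/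
theorem exists_unit_normal (hr : r = 0 ∨ r = 1) (c : ContactMetric M r) (x : M) :
    ∃ u, c.eta x u = 0 ∧ c.g x u u = 1 := by
  suffices h : ∃ u, c.eta x u = 0 ∧ 0 < c.g x u u by
    obtain ⟨u, h0, hu⟩ := h
    refine ⟨(Real.sqrt (c.g x u u))⁻¹ • u, by simp [h0], ?_⟩
    have hs := Real.mul_self_sqrt hu.le
    have hs0 := (Real.sqrt_pos.2 hu).ne'
    simp only [map_smul, smul_apply, smul_eq_mul]
    field_simp
    nlinarith
  obtain ⟨e, he⟩ := c.signature x
  have he : c.toPseudoMetric.IsOrthonormal x e := he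
  have hsum := sum_eta_sq he
  have hP : ∀ k, c.eta x (e k - c.eta x (e k) • c.xi x) = 0
      ∧ c.g x (e k - c.eta x (e k) • c.xi x) (e k - c.eta x (e k) • c.xi x)
        = sgn r k - (-1) ^ r * (c.eta x (e k) * c.eta x (e k)) := by
    intro k
    refine ⟨by simp [c.eta_xi], ?_⟩
    simp only [map_sub, map_smul, sub_apply, smul_apply, smul_eq_mul, he k k, c.g_xi, c.eta_xi,
      c.symm x (e k) (c.xi x), if_true]
    ring
  by_contra hcon
  push Not at hcon
  have h1 := hcon _ (hP 1).1
  have h2 := hcon _ (hP 2).1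
  have h0 := hcon _ (hP 0).1
  rw [(hP _).2] at h0 h1 h2
  rcases hr with rfl | rfl <;> simp [sgn, Fin.sum_univ_three] at h0 h1 h2 hsum <;>
    nlinarith [mul_self_nonneg (c.eta x (e 1))]

theorem isOrthonormal_adapted {u : TangentSpace 𝓘(ℝ, E3) x} (h0 : c.eta x u = 0)
    (h1 : c.g x u u = 1) : c.toPseudoMetric.IsOrthonormal x ![c.xi x, u, c.phi x u] := by
  have h11 : c.g x (c.phi x u) (c.phi x u) = 1 := by rw [c.g_phi_phi, h0, h1]; ring
  have h12 : c.g x u (c.phi x u) = 0 := by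
    have h := c.g_phi_phi x u (c.phi x u)
    rw [c.phi_phi, h0, c.eta_phi, zero_smul, add_zero, map_neg, c.symm x (c.phi x u)] at h
    linarith
  intro i j
  fin_cases i <;> fin_cases j <;>
    simp [sgn, c.g_xi, c.eta_xi, c.eta_phi, h0, h1, h11, h12, c.symm x u (c.xi x),
      c.symm x (c.phi x u) (c.xi x), c.symm x (c.phi x u) u]

variable {e : Fin 3 → Π x : M, TangentSpace 𝓘(ℝ, E3) x} {H : ℝ}

theorem riem_xi (hc : IsSasakianSpaceForm c H) (he : c.toPseudoMetric.IsFrameAt e x)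
    (v w : TangentSpace 𝓘(ℝ, E3) x) :
    c.riem x v w (c.xi x) = c.eta x w • v - c.eta x v • w := by
  have h := hc.sasakian x _ _ (PseudoMetric.smoothAt_extend v) (PseudoMetric.smoothAt_extend w)
  rw [← he.riem_apply (PseudoMetric.smoothAt_extend _) (PseudoMetric.smoothAt_extend _)
    (c.smooth_xi x)] at h
  simpa using h

theorem riem_phi (hc : IsSasakianSpaceForm c H) (he : c.toPseudoMetric.IsFrameAt e x)
    {u : TangentSpace 𝓘(ℝ, E3) x} (h0 : c.eta x u = 0) (h1 : c.g x u u = 1) :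
    c.g x (c.riem x u (c.phi x u) (c.phi x u)) u = H := by
  have hu := PseudoMetric.smoothAt_extend u
  have h := hc.phiSectional x _ hu (by simpa using h0)
  rw [← he.riem_apply hu (c.smooth_phi x _ hu) (c.smooth_phi x _ hu)] at h
  have h12 := isOrthonormal_adapted h0 h1 1 2
  have h22 := isOrthonormal_adapted h0 h1 2 2
  simp [sgn] at h12 h22
  simpa [h1, h12, h22] using h

/-- The Ricci form of a Sasakian space-form, on tangent vectors. -/
theorem trace_riem (hr : r = 0 ∨ r = 1) (hc : IsSasakianSpaceForm c H)
    (he : c.toPseudoMetric.IsFrameAt e x) (y z : TangentSpace 𝓘(ℝ, E3) x) :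
    ∑ k, sgn r k * c.g x (c.riem x (e k x) y z) (e k x)
      = (H + (-1) ^ r) * c.g x y z + (1 - (-1) ^ r * H) * (c.eta x y * c.eta x z) := by
  obtain ⟨u, h0, h1⟩ := c.exists_unit_normal hr x
  have hf := isOrthonormal_adapted h0 h1
  let A : TangentSpace 𝓘(ℝ, E3) x →ₗ[ℝ] TangentSpace 𝓘(ℝ, E3) x :=
    { toFun := fun v ↦ c.riem x v y z
      map_add' := fun _ _ ↦ he.riem_add_left _ _ _ _
      map_smul' := fun _ _ ↦ he.riem_smul_left _ _ _ _ }
  -- The trace is moved to the adapted basis `ξ, u, φu`, where the hypotheses and the symmetries of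
  -- the curvature give every component.
  have htr := he.orthonormal.self_of_nhds.trace_eq hf A
  simp only [A, LinearMap.coe_mk, AddHom.coe_mk] at htr
  rw [htr]
  set w := c.phi x u with hw
  have hwη : c.eta x w = 0 := c.eta_phi x u
  have g01 := hf 0 1
  have g02 := hf 0 2
  have g12 := hf 1 2
  have g00 := hf 0 0
  have g22 := hf 2 2
  simp [sgn] at g01 g02 g12 g00 g22
  have g10 := (c.symm x u (c.xi x)).trans g01
  have g20 := (c.symm x w (c.xi x)).trans g02
  have g21 := (c.symm x w u).trans g12
  have R : ∀ a b, c.riem x a b (c.xi x) = c.eta x b • a - c.eta x a • b := riem_xi hc he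
  have D : ∀ a b d, c.g x (c.riem x a b d) d = 0 := fun a b d ↦ by
    have := he.riem_skew a b d d; linarith
  have Z : ∀ a b d, c.g x (c.riem x a a b) d = 0 := fun a b d ↦ by
    have h := he.riem_swap a a b
    have h' := congrArg (fun v ↦ c.g x v d) h
    simp only [map_neg, neg_apply] at h'
    linarith
  have hH : c.g x (c.riem x u w w) u = H := riem_phi hc he h0 h1
  have hH' : c.g x (c.riem x w u u) w = H := by
    rw [he.riem_skew, he.riem_swap, map_neg, neg_apply, neg_neg, hH]
  have k0 : ∀ b d, c.g x (c.riem x (c.xi x) b d) (c.xi x)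
      = c.g x b d - c.eta x b * c.g x (c.xi x) d := by
    intro b d
    rw [he.riem_skew, he.riem_swap, map_neg, neg_apply, neg_neg, R]
    simp [c.eta_xi]
  -- In the Bianchi identity paired with `a`, the term `R(b,a)ξ` vanishes because `a, b ∈ ker η`,
  -- and `g(R(ξ,b)a, a)` vanishes by skewness.
  have B : ∀ a b, c.eta x a = 0 → c.eta x b = 0 → c.g x (c.riem x a (c.xi x) b) a = 0 := by
    intro a b ha hb
    have h := congrArg (fun v ↦ c.g x v a) (he.riem_bianchi a (c.xi x) b)
    simp only [map_add, add_apply, map_zero, zero_apply, R, ha, hb, D] at h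
    simpa using h
  have k1 : ∀ a b, c.g x (c.riem x a b (c.xi x)) a
      = c.eta x b * c.g x a a - c.eta x a * c.g x b a := by
    intro a b; rw [R]; simp
  have hex : ∀ v, ∃ a b d : ℝ, v = a • c.xi x + b • u + d • w := fun v ↦
    ⟨_, _, _, (hf.expand v).trans (Fin.sum_univ_three _)⟩
  obtain ⟨y0, y1, y2, rfl⟩ := hex y
  obtain ⟨z0, z1, z2, rfl⟩ := hex z
  rw [Fin.sum_univ_three]
  simp only [sgn, Matrix.cons_val_zero, Matrix.cons_val_one, Matrix.cons_val, he.riem_add_mid,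
    he.riem_smul_mid, he.riem_add, he.riem_smul, map_add, map_smul, add_apply, smul_apply,
    smul_eq_mul, Z, D, k0, k1, B u w h0 hwη, B w u hwη h0, hH, hH', g00, g01, g02, g10, g12, g20,
    g21, g22, h1, h0, hwη, c.eta_xi, if_true]
  simp
  linear_combination (-(y0 * z0)) * neg_one_pow_mul_self r

theorem ric_eq (hr : r = 0 ∨ r = 1) (hc : IsSasakianSpaceForm c H)
    (he : c.toPseudoMetric.IsFrameAt e x) {Y Z : Π x : M, TangentSpace 𝓘(ℝ, E3) x}
    (hY : SmoothAt Y x) (hZ : SmoothAt Z x) :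
    c.ric e Y Z x = (H + (-1) ^ r) * c.g x (Y x) (Z x)
      + (1 - (-1) ^ r * H) * (c.eta x (Y x) * c.eta x (Z x)) := by
  rw [← trace_riem hr hc he]
  simp only [PseudoMetric.ric, he.riem_apply (he.smooth _) hY hZ]

theorem scal_eq (hr : r = 0 ∨ r = 1) (hc : IsSasakianSpaceForm c H)
    (he : c.toPseudoMetric.IsFrameAt e x) : c.scal e x = 2 * H + 4 * (-1) ^ r := by
  have ho := he.orthonormal.self_of_nhds
  have h1 : ∀ k, c.g x (e k x) (e k x) = sgn r k := fun k ↦ by simp [ho k k]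
  simp only [PseudoMetric.scal, ric_eq hr hc he (he.smooth _) (he.smooth _), h1, mul_add,
    Finset.sum_add_distrib]
  have h2 := sum_eta_sq ho
  have h3 : ∑ k, sgn r k * ((1 - (-1) ^ r * H) * (c.eta x (e k x) * c.eta x (e k x)))
      = (1 - (-1) ^ r * H) * (-1) ^ r := by
    rw [← h2, Finset.mul_sum]
    exact Finset.sum_congr rfl fun k _ ↦ by ring
  have h4 : ∑ k, sgn r k * ((H + (-1) ^ r) * sgn r k) = 3 * (H + (-1) ^ r) := by
    simp only [mul_left_comm _ (H + (-1) ^ r), sgn_mul_self]; simp; ring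
  rw [h3, h4]
  linear_combination (-H) * neg_one_pow_mul_self r

end ContactMetric

end Sasakian

/-! ### Algebra of the gamma matrices, the invariant form and the Lorentzian real structure. -/

section GammaMatrices

open Complex

theorem gam_riemannian :
    gam 0 = ![!![0, I; I, 0], !![0, 1; -1, 0], !![I, 0; 0, -I]] := by
  unfold gam
  congr 1
  · ext i j; fin_cases i <;> fin_cases j <;> simp
  · congr 1
    · ext i j; fin_cases i <;> fin_cases j <;> simp
    · congr 1
      ext i j; fin_cases i <;> fin_cases j <;> simp

theorem gam_lorentzian :
    gam 1 = ![!![0, 1; 1, 0], !![0, 1; -1, 0], !![I, 0; 0, -I]] := by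
  unfold gam
  congr 1
  · ext i j; fin_cases i <;> fin_cases j <;> simp
  · congr 1
    · ext i j; fin_cases i <;> fin_cases j <;> simp
    · congr 1
      ext i j; fin_cases i <;> fin_cases j <;> simp

variable {r : ℕ}

theorem gam_mul_self (hr : r = 0 ∨ r = 1) (k : Fin 3) :
    gam r k * gam r k = -((sgn r k : ℝ) : ℂ) • (1 : Matrix (Fin 2) (Fin 2) ℂ) := by
  rcases hr with rfl | rfl
  · rw [gam_riemannian]
    fin_cases k <;> ext i j <;> fin_cases i <;> fin_cases j <;> simp [sgn]
  · rw [gam_lorentzian]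
    fin_cases k <;> ext i j <;> fin_cases i <;> fin_cases j <;> simp [sgn]

/-- For `k ≠ l` the product lies in the spin Lie algebra, which is skew for the form; for `k = l` it
is the scalar `-sgn r k`. -/
theorem re_pairing_gam_mul_gam (hr : r = 0 ∨ r = 1) (p : Fin 2 → ℂ) (k l : Fin 3) :
    (pairing r p ((gam r k * gam r l) *ᵥ p)).re = if k = l then -(sgn r k * sq r p) else 0 := by
  rcases hr with rfl | rfl
  · simp only [sq, pairing, gam_riemannian]
    fin_cases k <;> fin_cases l <;>
      simp [sgn, Matrix.mulVec, dotProduct, Fin.sum_univ_two] <;> ring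
  · simp only [sq, pairing, gam_lorentzian]
    fin_cases k <;> fin_cases l <;>
      simp [sgn, Matrix.mulVec, dotProduct, Fin.sum_univ_two] <;> ring

/-- The factor `(√-1)^r` is what makes Clifford multiplication skew in both signatures. -/
theorem re_pairing_gam (hr : r = 0 ∨ r = 1) (p : Fin 2 → ℂ) (k : Fin 3) :
    (pairing r p ((I ^ r • gam r k) *ᵥ p)).re = 0 := by
  rcases hr with rfl | rfl
  · simp only [pairing, gam_riemannian]
    fin_cases k <;> simp [Matrix.mulVec, dotProduct, Fin.sum_univ_two] <;> ring
  · simp only [pairing, gam_lorentzian]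
    fin_cases k <;> simp [Matrix.mulVec, dotProduct, Fin.sum_univ_two] <;> ring

theorem sq_pos_riemannian {p : Fin 2 → ℂ} (h : sq 0 p ≠ 0) : 0 < sq 0 p := by
  refine lt_of_le_of_ne ?_ h.symm
  simp [sq, pairing, dotProduct, Fin.sum_univ_two]
  nlinarith [mul_self_nonneg (p 0).re, mul_self_nonneg (p 0).im, mul_self_nonneg (p 1).re,
    mul_self_nonneg (p 1).im]

theorem pairing_add (p q q' : Fin 2 → ℂ) :
    pairing r p (q + q') = pairing r p q + pairing r p q' := by
  rw [pairing, Matrix.mulVec_add, dotProduct_add]; rfl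

theorem pairing_smul (z : ℂ) (p q : Fin 2 → ℂ) : pairing r p (z • q) = z * pairing r p q := by
  rw [pairing, Matrix.mulVec_smul, dotProduct_smul, smul_eq_mul]; rfl

theorem pairing_sum {α : Type*} (s : Finset α) (p : Fin 2 → ℂ) (q : α → Fin 2 → ℂ) :
    pairing r p (∑ k ∈ s, q k) = ∑ k ∈ s, pairing r p (q k) := by
  simp [pairing, Matrix.mulVec_sum, dotProduct_sum]

theorem sq_smul (a : ℝ) (p : Fin 2 → ℂ) : sq r ((a : ℂ) • p) = a * a * sq r p := by
  have h : star ((a : ℂ) • p) = (a : ℂ) • star p := by ext i; simp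
  simp only [sq, pairing, h, Matrix.mulVec_smul, smul_dotProduct, dotProduct_smul, smul_eq_mul]
  simp [mul_assoc]

theorem sq_mulVec {h : Matrix (Fin 2) (Fin 2) ℂ} (hh : hᴴ * gam r 0 ^ r * h = gam r 0 ^ r)
    (p : Fin 2 → ℂ) : sq r (h *ᵥ p) = sq r p := by
  simp only [sq, pairing, Matrix.star_mulVec]
  rw [← Matrix.dotProduct_mulVec, Matrix.mulVec_mulVec, Matrix.mulVec_mulVec, hh]

theorem pairing_conj_symm (hr : r = 0 ∨ r = 1) (p q : Fin 2 → ℂ) :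
    (pairing r p q).re = (pairing r q p).re := by
  rcases hr with rfl | rfl
  · simp [pairing, dotProduct, Fin.sum_univ_two]; ring
  · simp [pairing, gam_lorentzian, Matrix.mulVec, dotProduct, Fin.sum_univ_two]; ring

variable (r) in
/-- The real bilinear form `Re ⟨ψ₁, ψ₂⟩` on `ℂ²`. -/
noncomputable def rePairing : (Fin 2 → ℂ) →L[ℝ] (Fin 2 → ℂ) →L[ℝ] ℝ :=
  (LinearMap.mk₂ ℝ (fun p q ↦ (pairing r p q).re)
    (fun p p' q ↦ by rw [pairing, star_add, add_dotProduct, Complex.add_re]; rfl) (fun a p q ↦ by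
      have h : star (a • p) = (a : ℂ) • star p := by ext i; simp
      rw [pairing, h, smul_dotProduct, smul_eq_mul, Complex.re_ofReal_mul]; rfl)
    (fun p q q' ↦ by simp [pairing_add]) (fun a p q ↦ by
      have h : a • q = (a : ℂ) • q := by ext i; simp
      rw [h, pairing_smul]; simp)).toContinuousBilinearMap

theorem rePairing_apply (p q : Fin 2 → ℂ) : rePairing r p q = (pairing r p q).re := rfl

theorem hasFDerivAt_sq (hr : r = 0 ∨ r = 1) (p : Fin 2 → ℂ) :
    HasFDerivAt (sq r) ((2 : ℝ) • rePairing r p) p := by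
  have h := (rePairing r).hasFDerivAt_of_bilinear (hasFDerivAt_id p) (hasFDerivAt_id p)
  refine h.congr_fderiv ?_
  ext q
  simp [rePairing_apply, pairing_conj_symm hr q p, two_mul]

/-- A real-linear map of `ℂ²` that commutes with a matrix. -/
def Commutes (L : (Fin 2 → ℂ) →L[ℝ] (Fin 2 → ℂ)) (A : Matrix (Fin 2) (Fin 2) ℂ) : Prop :=
  ∀ p, L (A *ᵥ p) = A *ᵥ L p

theorem Commutes.add {L : (Fin 2 → ℂ) →L[ℝ] (Fin 2 → ℂ)} {A B : Matrix (Fin 2) (Fin 2) ℂ}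
    (hA : Commutes L A) (hB : Commutes L B) : Commutes L (A + B) := fun p ↦ by
  rw [Matrix.add_mulVec, map_add, hA p, hB p, Matrix.add_mulVec]

theorem Commutes.smul {L : (Fin 2 → ℂ) →L[ℝ] (Fin 2 → ℂ)} {A : Matrix (Fin 2) (Fin 2) ℂ}
    (hA : Commutes L A) (a : ℝ) : Commutes L ((a : ℂ) • A) := fun p ↦ by
  have h : ∀ q : Fin 2 → ℂ, (a : ℂ) • q = a • q := fun q ↦ by ext i; simp
  rw [Matrix.smul_mulVec, h, map_smul, hA p, Matrix.smul_mulVec, h]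

theorem Commutes.sum {L : (Fin 2 → ℂ) →L[ℝ] (Fin 2 → ℂ)} {A : Fin 3 → Matrix (Fin 2) (Fin 2) ℂ}
    (hA : ∀ k, Commutes L (A k)) : Commutes L (∑ k, A k) := by
  rw [Fin.sum_univ_three]
  exact ((hA 0).add (hA 1)).add (hA 2)

/-- The real structure `ψ ↦ σ₃ ψ̄` on `ℂ²`. -/
noncomputable def realStr : (Fin 2 → ℂ) →L[ℝ] (Fin 2 → ℂ) :=
  LinearMap.toContinuousLinearMap
    { toFun := fun p ↦ ![star (p 0), -star (p 1)]
      map_add' := fun p q ↦ by ext i; fin_cases i <;> simp [add_comm]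
      map_smul' := fun a p ↦ by ext i; fin_cases i <;> simp }

theorem realStr_apply (p : Fin 2 → ℂ) : realStr p = ![star (p 0), -star (p 1)] := rfl

/-- A matrix commutes with `realStr` exactly when its diagonal is real and its off-diagonal entries
are imaginary. The matrices `√-1 γ_k` have this shape, hence so do the products `γ_k γ_l`. -/
theorem commutes_realStr_gam_mul_gam (k l : Fin 3) :
    Commutes realStr (gam 1 k * gam 1 l) := by
  intro p
  simp only [realStr_apply, gam_lorentzian]
  fin_cases k <;> fin_cases l <;> ext i <;> fin_cases i <;>
    simp [Matrix.mulVec, dotProduct, Fin.sum_univ_two]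

theorem commutes_realStr_gam (k : Fin 3) : Commutes realStr (I ^ 1 • gam 1 k) := by
  intro p
  simp only [realStr_apply, gam_lorentzian]
  fin_cases k <;> ext i <;> fin_cases i <;>
    simp [Matrix.mulVec, dotProduct, Fin.sum_univ_two]

theorem commutes_realStr_spin {h : Matrix (Fin 2) (Fin 2) ℂ} (hdet : h.det = 1)
    (hh : hᴴ * gam 1 0 ^ 1 * h = gam 1 0 ^ 1) : Commutes realStr h := by
  -- With determinant one the inverse is the adjugate, so invariance of the form becomes linear in
  -- `h` and its conjugate: it says that the diagonal is real and the rest imaginary.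
  have hinv : hᴴ * gam 1 0 ^ 1 = gam 1 0 ^ 1 * h.adjugate := by
    conv_rhs => rw [← hh, mul_assoc _ h, Matrix.mul_adjugate, hdet, one_smul, mul_one]
  have e := fun i j ↦ congrFun (congrFun hinv i) j
  have e00 := e 0 0
  have e01 := e 0 1
  have e10 := e 1 0
  have e11 := e 1 1
  simp [gam_lorentzian, Matrix.adjugate_fin_two, Matrix.mul_apply, Fin.sum_univ_two]
    at e00 e01 e10 e11
  intro p
  simp only [realStr_apply]
  ext i; fin_cases i <;>
    simp [Matrix.mulVec, dotProduct, Fin.sum_univ_two, e00, e01, e10, e11]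
  ring

/-- In index one `⟨p,p⟩ = 2 Re (p̄₀ p₁)`, and `realStr` conjugates both components and negates one.
-/
theorem sq_realStr (p : Fin 2 → ℂ) : sq 1 (realStr p) = -sq 1 p := by
  simp [sq, pairing, realStr_apply, gam_lorentzian, Matrix.mulVec, dotProduct, Fin.sum_univ_two]
  ring

end GammaMatrices

/-! ### Functions with vanishing derivative are locally constant. -/

section LocallyConstant

variable {M : Type*} [TopologicalSpace M] [ChartedSpace E3 M] [IsManifold 𝓘(ℝ, E3) ∞ M]

theorem eventually_eq_of_mvfderiv_eq_zero {f : M → ℝ} {x : M}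
    (hf : ∀ᶠ y in 𝓝 x, DiffFun f y ∧ mvfderiv 𝓘(ℝ, E3) f y = 0) : ∀ᶠ y in 𝓝 x, f y = f x := by
  set φ := extChartAt 𝓘(ℝ, E3) x with hφ
  have htgt : φ.target ∈ 𝓝 (φ x) := extChartAt_target_mem_nhds x
  have hcont : ContinuousAt φ.symm (φ x) := continuousAt_extChartAt_symm x
  have hf' : ∀ᶠ z in 𝓝 (φ x), DiffFun f (φ.symm z) ∧ mvfderiv 𝓘(ℝ, E3) f (φ.symm z) = 0 := by
    refine hcont.eventually (p := fun y ↦ DiffFun f y ∧ mvfderiv 𝓘(ℝ, E3) f y = 0) ?_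
    rwa [extChartAt_to_inv]
  obtain ⟨ρ, hρ, hball⟩ := Metric.eventually_nhds_iff_ball.1 (hf'.and htgt)
  have hd : ∀ z ∈ Metric.ball (φ x) ρ, HasFDerivAt (f ∘ φ.symm) (0 : E3 →L[ℝ] ℝ) z := by
    intro z hz
    obtain ⟨⟨h1, h2⟩, h3⟩ := hball z hz
    have hs : MDifferentiableAt 𝓘(ℝ, E3) 𝓘(ℝ, E3) φ.symm z := by
      have := mdifferentiableWithinAt_extChartAt_symm (I := 𝓘(ℝ, E3)) h3
      rwa [ModelWithCorners.range_eq_univ, mdifferentiableWithinAt_univ] at this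
    have h4 := HasMFDerivAt.comp z (MDifferentiableAt.hasMFDerivAt h1) hs.hasMFDerivAt
    have h5 : mfderiv 𝓘(ℝ, E3) 𝓘(ℝ, ℝ) f (φ.symm z) = 0 := by
      ext v
      exact congrArg (fun L : E3 →L[ℝ] ℝ ↦ L v) h2
    rw [h5] at h4
    have h6 := h4.hasFDerivAt
    refine h6.congr_fderiv ?_
    ext v; rfl
  -- In a chart the statement is the mean value inequality on a convex ball.
  have hconst : ∀ z ∈ Metric.ball (φ x) ρ, (f ∘ φ.symm) z = (f ∘ φ.symm) (φ x) := by
    intro z hz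
    refine (convex_ball (φ x) ρ).is_const_of_fderivWithin_eq_zero (𝕜 := ℝ)
      (fun y hy ↦ (hd y hy).differentiableAt.differentiableWithinAt) (fun y hy ↦ ?_) hz
      (Metric.mem_ball_self hρ)
    rw [fderivWithin_of_isOpen Metric.isOpen_ball hy, (hd y hy).fderiv]
  have hc : ContinuousAt φ x := continuousAt_extChartAt x
  filter_upwards [hc.eventually (Metric.ball_mem_nhds (φ x) hρ),
    extChartAt_source_mem_nhds (I := 𝓘(ℝ, E3)) x] with y hy hys
  have := hconst (φ y) hy
  rwa [Function.comp_apply, Function.comp_apply, φ.left_inv hys, extChartAt_to_inv] at this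

end LocallyConstant

/-! ### Arithmetic of the parameters in the three cases. -/

namespace Kind

variable {r : ℕ} {H : ℝ} (t : Kind)

theorem lam_eq (hr : r = 0 ∨ r = 1) : t.lam r H = -(-1) ^ r * (3 * t.a r H + t.b r H) := by
  rcases hr with rfl | rfl <;> cases t <;> simp [lam, a, b] <;> ring

/-- The (constant) value of `(S - 6Λ) / λ`, where `S = 2H + 4(-1)^r`. -/
theorem exists_scal_sub_eq (hr : r = 0 ∨ r = 1) (ht : t.Admissible r H) :
    ∃ μ : ℝ, 2 * H + 4 * (-1) ^ r - 6 * t.Lam r H = μ * t.lam r H ∧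
      t.b r H * μ = 2 * (1 - (-1) ^ r * H) ∧ (r = 0 → μ < 0) := by
  rcases hr with rfl | rfl
  · cases t with
    -- Every witness comes from solving `bμ = 2(1-εH)`. In (i), `1-εH = -4εb` gives `μ = -8ε`. In
    -- (ii) and (iii), `1-εH = (2-s)(2+s)` and `b` is `±1/2` times one factor, so `μ` is `±4` times
    -- the other and makes sense even if `b = 0`.
    | i => exact ⟨-8, by simp [lam, Lam]; ring, by simp [b]; ring, fun _ ↦ by norm_num⟩
    | ii =>
      simp only [Admissible, pow_zero, one_mul, forall_const] at ht
      have hs := Real.mul_self_sqrt (by linarith : 0 ≤ H + 3)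
      have hs0 := Real.sqrt_nonneg (H + 3)
      refine ⟨4 * (Real.sqrt (H + 3) - 2), ?_, ?_, fun _ ↦ ?_⟩
      · simp [lam, Lam]; nlinarith
      · simp [b]; nlinarith
      -- Here `μ = 4(s-2)`, negative precisely because `H < 1` means `s < 2`.
      · nlinarith [ht.2]
    | iii =>
      simp only [Admissible, pow_zero, one_mul] at ht
      have hs := Real.mul_self_sqrt (by linarith : 0 ≤ H + 3)
      have hs0 := Real.sqrt_nonneg (H + 3)
      refine ⟨4 * (-Real.sqrt (H + 3) - 2), ?_, ?_, fun _ ↦ ?_⟩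
      · simp [lam, Lam]; nlinarith
      · simp [b]; nlinarith
      · linarith
  · cases t with
    | i => exact ⟨8, by simp [lam, Lam]; ring, by simp [b]; ring, by simp⟩
    | ii =>
      simp [Admissible] at ht
      have hs := Real.mul_self_sqrt (by linarith : 0 ≤ -H + 3)
      refine ⟨4 * (Real.sqrt (-H + 3) + 2), ?_, ?_, by simp⟩
      · simp [lam, Lam]; nlinarith
      · simp [b]; nlinarith
    | iii =>
      simp [Admissible] at ht
      have hs := Real.mul_self_sqrt (by linarith : 0 ≤ -H + 3)
      refine ⟨4 * (-Real.sqrt (-H + 3) + 2), ?_, ?_, by simp⟩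
      · simp [lam, Lam]; nlinarith
      · simp [b]; nlinarith

end Kind

/-! ### SqK-spinors: constant length, Dirac equation, energy-momentum tensor. -/

section Spin

open Complex

variable {M : Type*} [TopologicalSpace M] [ChartedSpace E3 M] [IsManifold 𝓘(ℝ, E3) ∞ M] {r : ℕ}

theorem re_pairing_cliff_cliff (hr : r = 0 ∨ r = 1) (m : PseudoMetric M r)
    {e : Fin 3 → Π x : M, TangentSpace 𝓘(ℝ, E3) x} {x : M}
    (he : m.IsOrthonormal x fun k ↦ e k x) (v w : TangentSpace 𝓘(ℝ, E3) x) (p : Fin 2 → ℂ) :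
    (pairing r p (cliff m e x v *ᵥ (cliff m e x w *ᵥ p))).re = -(m.g x v w * sq r p) := by
  have h : cliff m e x v *ᵥ (cliff m e x w *ᵥ p)
      = ∑ k, ∑ l, ((sgn r k * m.g x v (e k x) * (sgn r l * m.g x w (e l x)) : ℝ) : ℂ) •
          ((gam r k * gam r l) *ᵥ p) := by
    rw [Matrix.mulVec_mulVec, cliff, cliff, Finset.sum_mul, Matrix.sum_mulVec]
    refine Finset.sum_congr rfl fun k _ ↦ ?_
    rw [Finset.mul_sum, Matrix.sum_mulVec]
    refine Finset.sum_congr rfl fun l _ ↦ ?_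
    rw [Matrix.smul_mul, Matrix.mul_smul, smul_smul, Matrix.smul_mulVec, ← ofReal_mul]
  rw [h, ← he.parseval v w, Finset.sum_mul, ← Finset.sum_neg_distrib]
  simp only [pairing_sum, pairing_smul, re_sum, re_ofReal_mul, re_pairing_gam_mul_gam hr]
  refine Finset.sum_congr rfl fun k _ ↦ ?_
  simp only [mul_ite, mul_zero, Finset.sum_ite_eq, Finset.mem_univ, if_true]
  linear_combination (-(sgn r k * m.g x v (e k x) * m.g x w (e k x) * sq r p)) * sgn_mul_self r k

theorem sum_gam_mul_self (hr : r = 0 ∨ r = 1) (z : Fin 3 → ℝ) :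
    (∑ k, ((z k : ℝ) : ℂ) • gam r k) * (∑ k, ((z k : ℝ) : ℂ) • gam r k)
      = ((-∑ k, sgn r k * (z k * z k) : ℝ) : ℂ) • (1 : Matrix (Fin 2) (Fin 2) ℂ) := by
  have hI : (I * I : ℂ) = -1 := I_mul_I
  simp only [Fin.sum_univ_three]
  rcases hr with rfl | rfl
  · rw [gam_riemannian]
    ext i j
    fin_cases i <;> fin_cases j <;>
      simp [Matrix.mul_apply, Fin.sum_univ_two, sgn] <;>
      first | ring1 | linear_combination ((z 0 : ℂ) ^ 2 + (z 2 : ℂ) ^ 2) * hI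
  · rw [gam_lorentzian]
    ext i j
    fin_cases i <;> fin_cases j <;>
      simp [Matrix.mul_apply, Fin.sum_univ_two, sgn] <;>
      first | ring1 | linear_combination ((z 2 : ℂ) ^ 2) * hI

namespace SpinStructure

variable {c : ContactMetric M r} {ι : Type*} (S : SpinStructure c ι)

theorem isOrthonormal {i : ι} {x : M} (hx : x ∈ S.U i) :
    c.toPseudoMetric.IsOrthonormal x fun k ↦ S.e i k x := S.orthonormal i x hx

theorem isFrameAt {i : ι} {x : M} (hx : x ∈ S.U i) : c.toPseudoMetric.IsFrameAt (S.e i) x :=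
  ⟨fun k ↦ S.smooth_e i k x hx,
    ((S.isOpen i).eventually_mem hx).mono fun _ hy ↦ S.isOrthonormal hy⟩

/-- The connection matrix of the spinorial Levi-Civita connection. -/
noncomputable def connMat (i : ι) (x : M) (v : TangentSpace 𝓘(ℝ, E3) x) :
    Matrix (Fin 2) (Fin 2) ℂ :=
  (1 / 4 : ℂ) • ∑ k, ∑ l,
    ((sgn r k * sgn r l * c.g x (c.nabla (S.e i k) x v) (S.e i l x) : ℝ) : ℂ) •
      (gam r k * gam r l)

variable {S} {psi phi : ι → M → (Fin 2 → ℂ)} {i : ι} {x : M} {a b : ℝ}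

theorem spinNabla_eq (v : TangentSpace 𝓘(ℝ, E3) x) :
    S.spinNabla psi i x v = mvfderiv 𝓘(ℝ, E3) (psi i) x v + S.connMat i x v *ᵥ psi i x := rfl

theorem IsSpinor.diffAt (hpsi : S.IsSpinor psi) (hx : x ∈ S.U i) :
    MDifferentiableAt 𝓘(ℝ, E3) 𝓘(ℝ, Fin 2 → ℂ) (psi i) x :=
  ((hpsi.smooth i).contMDiffAt ((S.isOpen i).mem_nhds hx)).mdifferentiableAt (by simp)

/-- The terms with `k = l` vanish since `g(e_k, e_k)` is constant, and those with `k ≠ l` since `γ_k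
γ_l` is skew. -/
theorem re_pairing_connMat (hr : r = 0 ∨ r = 1) (hx : x ∈ S.U i)
    (v : TangentSpace 𝓘(ℝ, E3) x) (p : Fin 2 → ℂ) :
    (pairing r p (S.connMat i x v *ᵥ p)).re = 0 := by
  have hk : ∀ k, c.g x (c.nabla (S.e i k) x v) (S.e i k x) = 0 := by
    intro k
    obtain ⟨X, hX, rfl⟩ := exists_smoothAt v
    have hd := (S.smooth_e i k x hx).diffAt
    have h := PseudoMetric.nabla_metric (m := c.toPseudoMetric) hX.diffAt hd hd
    have h0 : c.gf (S.e i k) (S.e i k) =ᶠ[𝓝 x] fun _ ↦ sgn r k :=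
      ((S.isOpen i).eventually_mem hx).mono fun y hy ↦ by
        simp [PseudoMetric.gf, S.orthonormal i y hy k k]
    rw [along_congr h0, along_const] at h
    linarith
  have h4 : (1 / 4 : ℂ) = ((1 / 4 : ℝ) : ℂ) := by norm_num
  rw [connMat, h4]
  simp only [Matrix.smul_mulVec, Matrix.sum_mulVec, pairing_smul, pairing_sum, re_ofReal_mul,
    re_sum, re_pairing_gam_mul_gam hr, mul_ite, mul_zero, Finset.sum_ite_eq, Finset.mem_univ,
    if_true, hk, zero_mul, Finset.sum_const_zero]

theorem I_pow_smul_cl (i : ι) (x : M) (v : TangentSpace 𝓘(ℝ, E3) x) :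
    I ^ r • S.cl i x v = ∑ k, ((sgn r k * c.g x v (S.e i k x) : ℝ) : ℂ) • (I ^ r • gam r k) := by
  rw [cl, cliff, Finset.smul_sum]
  exact Finset.sum_congr rfl fun k _ ↦ smul_comm _ _ _

theorem re_pairing_cl (hr : r = 0 ∨ r = 1) (v : TangentSpace 𝓘(ℝ, E3) x) (p : Fin 2 → ℂ) :
    (pairing r p ((I ^ r • S.cl i x v) *ᵥ p)).re = 0 := by
  simp only [I_pow_smul_cl, Matrix.sum_mulVec, Matrix.smul_mulVec, pairing_sum, re_sum]
  refine Finset.sum_eq_zero fun k _ ↦ ?_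
  have h := re_pairing_gam hr p k
  rw [Matrix.smul_mulVec] at h
  rw [pairing_smul, re_ofReal_mul, h, mul_zero]

theorem IsSqK.spinNabla_eq (hpsi : S.IsSqK a b psi) (hx : x ∈ S.U i)
    (v : TangentSpace 𝓘(ℝ, E3) x) :
    S.spinNabla psi i x v
      = (a : ℂ) • ((I ^ r • S.cl i x v) *ᵥ psi i x)
        + ((b * c.eta x v : ℝ) : ℂ) • ((I ^ r • S.cl i x (c.xi x)) *ᵥ psi i x) := by
  rw [hpsi.eqn i x hx v, Matrix.smul_mulVec, Matrix.smul_mulVec, smul_smul, smul_smul,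
    ofReal_mul]
  congr 2
  ring

/-- The length of an SqK-spinor has zero derivative. -/
theorem IsSqK.mvfderiv_sq (hr : r = 0 ∨ r = 1) (hpsi : S.IsSqK a b psi) (hx : x ∈ S.U i) :
    DiffFun (fun y ↦ sq r (psi i y)) x
      ∧ mvfderiv 𝓘(ℝ, E3) (fun y ↦ sq r (psi i y)) x = 0 := by
  have hd := hpsi.spinor.diffAt hx
  have hc := HasMFDerivAt.comp x (hasFDerivAt_sq hr (psi i x)).hasMFDerivAt hd.hasMFDerivAt
  refine ⟨hc.mdifferentiableAt, ?_⟩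
  ext v
  have h1 : mvfderiv 𝓘(ℝ, E3) (fun y ↦ sq r (psi i y)) x v
      = 2 * (pairing r (psi i x) (mvfderiv 𝓘(ℝ, E3) (psi i) x v)).re :=
    congrArg (fun L : E3 →L[ℝ] ℝ ↦ L v) hc.mfderiv
  have h2 : mvfderiv 𝓘(ℝ, E3) (psi i) x v
      = S.spinNabla psi i x v + (-1 : ℝ) • (S.connMat i x v *ᵥ psi i x) := by
    rw [SpinStructure.spinNabla_eq]; module
  have h3 : ∀ q : Fin 2 → ℂ, (-1 : ℝ) • q = ((-1 : ℝ) : ℂ) • q := fun q ↦ by ext; simp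
  rw [h1, h2, h3, pairing_add, pairing_smul, add_re, re_ofReal_mul,
    re_pairing_connMat hr hx, hpsi.spinNabla_eq hx, pairing_add, pairing_smul, pairing_smul,
    add_re, re_ofReal_mul, re_ofReal_mul, re_pairing_cl hr, re_pairing_cl hr]
  simp

/-- The length of an SqK-spinor on a connected manifold is constant. -/
theorem IsSqK.exists_sq_eq [PreconnectedSpace M] (hr : r = 0 ∨ r = 1)
    (hpsi : S.IsSqK a b psi) : ∃ q : ℝ, ∀ i, ∀ x ∈ S.U i, sq r (psi i x) = q := by
  choose κ hκ using S.cover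
  -- The transition functions preserve the form, so the local lengths define one global function.
  have hκ' : ∀ i, ∀ x ∈ S.U i, sq r (psi i x) = sq r (psi (κ x) x) := fun i x hx ↦ by
    rw [hpsi.spinor.glue i (κ x) x ⟨hx, hκ x⟩, sq_mulVec (S.isometry_h _ _ x ⟨hx, hκ x⟩)]
  have hloc : IsLocallyConstant fun x ↦ sq r (psi (κ x) x) := by
    rw [IsLocallyConstant.iff_eventually_eq]
    intro x
    have hU := (S.isOpen (κ x)).eventually_mem (hκ x)
    filter_upwards [hU, eventually_eq_of_mvfderiv_eq_zero
      (hU.mono fun y hy ↦ hpsi.mvfderiv_sq hr hy)] with y hy h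
    rw [← hκ' _ y hy, h]
  obtain ⟨q, hq⟩ := hloc.exists_eq_const
  exact ⟨q, fun i x hx ↦ (hκ' i x hx).trans (congrFun hq x)⟩

theorem IsSqK.congr (hpsi : S.IsSqK a b psi) (h : ∀ i, ∀ x ∈ S.U i, phi i x = psi i x) :
    S.IsSqK a b phi where
  spinor :=
    { smooth := fun i ↦ (hpsi.spinor.smooth i).congr fun x hx ↦ h i x hx
      glue := fun i j x hx ↦ by
        rw [h i x hx.1, h j x hx.2, hpsi.spinor.glue i j x hx] }
  eqn := fun i x hx v ↦ by
    have h1 : phi i =ᶠ[𝓝 x] psi i := ((S.isOpen i).eventually_mem hx).mono fun y hy ↦ h i y hy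
    have h2 := hpsi.eqn i x hx v
    rw [SpinStructure.spinNabla_eq, mvfderiv_congr h1, h i x hx]
    exact h2

/-- The image of an SqK-spinor under a real-linear map commuting with the Clifford action and the
spin group is an SqK-spinor. -/
theorem IsSqK.map (hpsi : S.IsSqK a b psi) {L : (Fin 2 → ℂ) →L[ℝ] (Fin 2 → ℂ)}
    (h1 : ∀ k, Commutes L (I ^ r • gam r k)) (h2 : ∀ k l, Commutes L (gam r k * gam r l))
    (h3 : ∀ i j, ∀ x ∈ S.U i ∩ S.U j, Commutes L (S.h i j x)) :
    S.IsSqK a b fun i x ↦ L (psi i x) where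
  spinor :=
    { smooth := fun i ↦ L.contMDiff.comp_contMDiffOn (hpsi.spinor.smooth i)
      glue := fun i j x hx ↦ by rw [hpsi.spinor.glue i j x hx, h3 i j x hx] }
  eqn := fun i x hx v ↦ by
    have hd := hpsi.spinor.diffAt hx
    have hc := HasMFDerivAt.comp x (L.hasFDerivAt (x := psi i x)).hasMFDerivAt hd.hasMFDerivAt
    have hD : mvfderiv 𝓘(ℝ, E3) (fun y ↦ L (psi i y)) x v
        = L (mvfderiv 𝓘(ℝ, E3) (psi i) x v) :=
      congrArg (fun L : E3 →L[ℝ] (Fin 2 → ℂ) ↦ L v) hc.mfderiv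
    have hC : Commutes L (S.connMat i x v) := by
      have h4 : (1 / 4 : ℂ) = ((1 / 4 : ℝ) : ℂ) := by norm_num
      rw [connMat, h4]
      exact (Commutes.sum fun k ↦ Commutes.sum fun l ↦ (h2 k l).smul _).smul _
    have hcl : ∀ w, Commutes L (I ^ r • S.cl i x w) := fun w ↦ by
      rw [I_pow_smul_cl]
      exact Commutes.sum fun k ↦ (h1 k).smul _
    have h := congrArg L (hpsi.spinNabla_eq hx v)
    rw [SpinStructure.spinNabla_eq, map_add, hC, ← hD, map_add, ← Matrix.smul_mulVec,
      ← Matrix.smul_mulVec, (hcl v).smul a, (hcl _).smul _] at h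
    rw [SpinStructure.spinNabla_eq, h]
    simp only [Matrix.smul_mulVec, smul_smul, ofReal_mul]
    congr 2
    ring

theorem IsSqK.smul (hpsi : S.IsSqK a b psi) (z : ℝ) :
    S.IsSqK a b fun i x ↦ (z : ℂ) • psi i x := by
  have hL : ∀ A, Commutes (z • ContinuousLinearMap.id ℝ (Fin 2 → ℂ)) A := fun A p ↦ by
    simp [Matrix.mulVec_smul]
  refine (hpsi.map (fun _ ↦ hL _) (fun _ _ ↦ hL _) fun _ _ _ _ ↦ hL _).congr fun i x _ ↦ ?_
  ext; simp

/-- The `a`-terms contribute `∑ sgn r k γ_k γ_k = -3`. The `b`-terms sum to `ε ξ·ξ· = -1`. The two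
factors `(√-1)^r` multiply to `ε`. -/
theorem IsSqK.dirac_eq (hr : r = 0 ∨ r = 1) (hpsi : S.IsSqK a b psi) (hx : x ∈ S.U i) :
    S.dirac psi i x = ((-(-1) ^ r * (3 * a + b) : ℝ) : ℂ) • psi i x := by
  have ho := S.isOrthonormal hx
  have hI : (I ^ r * I ^ r : ℂ) = ((-1) ^ r : ℝ) := by rw [← mul_pow, I_mul_I]; simp
  have hcle : ∀ k, S.cl i x (S.e i k x) = gam r k := by
    intro k
    rw [cl, cliff, Finset.sum_eq_single k]
    · rw [S.orthonormal i x hx, if_pos rfl, sgn_mul_self, ofReal_one, one_smul]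
    · intro l _ hl
      rw [S.orthonormal i x hx, if_neg hl.symm, mul_zero, ofReal_zero, zero_smul]
    · simp
  set w := S.cl i x (c.xi x) with hw
  have hsum : ∑ k, ((sgn r k * c.eta x (S.e i k x) : ℝ) : ℂ) • gam r k
      = (((-1) ^ r : ℝ) : ℂ) • w := by
    rw [hw, cl, cliff, Finset.smul_sum]
    refine Finset.sum_congr rfl fun k _ ↦ ?_
    rw [smul_smul, ← ofReal_mul, c.g_xi]
    congr 2
    linear_combination (-(sgn r k * c.eta x (S.e i k x))) * neg_one_pow_mul_self r
  have hww : w * w = ((-(-1) ^ r : ℝ) : ℂ) • (1 : Matrix (Fin 2) (Fin 2) ℂ) := by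
    rw [hw, cl, cliff, sum_gam_mul_self hr, ← ContactMetric.sum_eta_sq ho]
    congr 3
    refine Finset.sum_congr rfl fun k _ ↦ ?_
    rw [c.g_xi]
    linear_combination (sgn r k * (c.eta x (S.e i k x)) ^ 2)
      * ((-1) ^ r * (-1) ^ r * sgn_mul_self r k + neg_one_pow_mul_self r)
  have hterm : ∀ k, ((sgn r k : ℝ) : ℂ) • (gam r k *ᵥ S.spinNabla psi i x (S.e i k x))
      = I ^ r • (((-a : ℝ) : ℂ) • psi i x)
        + I ^ r • ((b : ℂ) • ((((sgn r k * c.eta x (S.e i k x) : ℝ) : ℂ) • gam r k)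
          *ᵥ (w *ᵥ psi i x))) := by
    intro k
    rw [hpsi.spinNabla_eq hx, hcle, ← hw]
    simp only [Matrix.mulVec_add, Matrix.smul_mulVec, Matrix.mulVec_smul, smul_add]
    rw [Matrix.mulVec_mulVec _ (gam r k) (gam r k), gam_mul_self hr, Matrix.smul_mulVec,
      Matrix.one_mulVec]
    simp only [smul_smul]
    have h1 : ((sgn r k : ℝ) : ℂ) * (sgn r k : ℝ) = 1 := by
      rw [← ofReal_mul, sgn_mul_self, ofReal_one]
    congr 2
    · push_cast
      linear_combination (-(a * I ^ r) : ℂ) * h1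
    · push_cast
      ring
  rw [dirac]
  simp only [hterm]
  rw [Finset.sum_add_distrib, ← Finset.smul_sum, ← Finset.smul_sum, ← Finset.smul_sum,
    ← Finset.smul_sum, ← Matrix.sum_mulVec, hsum, Matrix.smul_mulVec, Matrix.mulVec_mulVec, hww,
    Matrix.smul_mulVec, Matrix.one_mulVec, smul_add, smul_smul (I ^ r), smul_smul (I ^ r), hI,
    Finset.sum_const, Finset.card_univ, Fintype.card_fin, ← Nat.cast_smul_eq_nsmul ℂ]
  simp only [smul_smul, ← add_smul]
  congr 1
  have e1 := congrArg (fun y : ℝ ↦ (y : ℂ)) (neg_one_pow_mul_self r)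
  push_cast at e1 ⊢
  linear_combination (-(b : ℂ) * (-1) ^ r) * e1

theorem IsSqK.energy_eq (hr : r = 0 ∨ r = 1) (hpsi : S.IsSqK a b psi) (hx : x ∈ S.U i)
    (v w : TangentSpace 𝓘(ℝ, E3) x) :
    S.energy psi i x v w = -(1 / 2) * sq r (psi i x)
      * ((-1) ^ r * a * c.g x v w + b * (c.eta x v * c.eta x w)) := by
  have ho := S.isOrthonormal hx
  have hI : (I ^ r * I ^ r : ℂ) = ((-1) ^ r : ℝ) := by rw [← mul_pow, I_mul_I]; simp
  -- Each half of the energy-momentum tensor is already symmetric, because taking real parts keeps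
  -- only the symmetric part of a Clifford product.
  have key : ∀ v w, (pairing r (psi i x) (I ^ r • (S.cl i x v *ᵥ S.spinNabla psi i x w))).re
      = -(-1) ^ r * (a * c.g x v w + (-1) ^ r * b * (c.eta x v * c.eta x w))
        * sq r (psi i x) := by
    intro v w
    rw [hpsi.spinNabla_eq hx w]
    simp only [Matrix.smul_mulVec, Matrix.mulVec_add, Matrix.mulVec_smul, smul_add]
    rw [smul_comm (I ^ r) (a : ℂ), smul_comm (I ^ r) ((b * c.eta x w : ℝ) : ℂ), smul_smul (I ^ r),
      smul_smul (I ^ r), hI]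
    simp only [pairing_add, pairing_smul, add_re, re_ofReal_mul]
    have h1 := re_pairing_cliff_cliff hr c.toPseudoMetric ho v w (psi i x)
    have h2 := re_pairing_cliff_cliff hr c.toPseudoMetric ho v (c.xi x) (psi i x)
    rw [c.symm x v, c.g_xi] at h2
    simp only [cl, h1, h2]
    ring
  rw [energy, smul_add, pairing_add, add_re, key, key, c.symm x w v]
  linear_combination (-(1 / 2) * b * c.eta x v * c.eta x w * sq r (psi i x))
    * neg_one_pow_mul_self r

theorem IsSqK.trEnergy_eq (hr : r = 0 ∨ r = 1) (hpsi : S.IsSqK a b psi) (hx : x ∈ S.U i) :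
    S.trEnergy psi i x = -(1 / 2) * sq r (psi i x) * ((-1) ^ r * (3 * a + b)) := by
  have h1 : ∀ k, c.g x (S.e i k x) (S.e i k x) = sgn r k := fun k ↦ by
    simp [S.orthonormal i x hx k k]
  have h2 := ContactMetric.sum_eta_sq (S.isOrthonormal hx)
  simp only [trEnergy, hpsi.energy_eq hr hx, h1]
  rw [Fin.sum_univ_three] at h2 ⊢
  linear_combination (-(1 / 2) * sq r (psi i x) * b) * h2
    + (-(1 / 2) * sq r (psi i x) * (-1) ^ r * a)
      * (sgn_mul_self r 0 + sgn_mul_self r 1 + sgn_mul_self r 2)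

/-- An SqK-spinor with the right parameters and the right length solves the Einstein-Dirac
system. -/
theorem IsSqK.solvesED (hr : r = 0 ∨ r = 1) {H μ lam Lam : ℝ} (hc : IsSasakianSpaceForm c H)
    (hpsi : S.IsSqK a b psi) (hlam : lam = -(-1) ^ r * (3 * a + b))
    (hμ : 2 * H + 4 * (-1) ^ r - 6 * Lam = μ * lam) (hb : b * μ = 2 * (1 - (-1) ^ r * H))
    (hsq : ∀ i, ∀ x ∈ S.U i, sq r (psi i x) = -μ) : S.SolvesED lam Lam psi where
  spinor := hpsi.spinor
  dirac_eq := fun i x hx ↦ by rw [hpsi.dirac_eq hr hx, hlam]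
  einstein_eq := fun i x hx X Y hX hY ↦ by
    rw [ContactMetric.ric_eq hr hc (S.isFrameAt hx) hX hY, hpsi.energy_eq hr hx,
      hpsi.trEnergy_eq hr hx, hsq i x hx]
    have e1 := neg_one_pow_mul_self r
    subst hlam
    generalize c.g x (X x) (Y x) = g
    generalize c.eta x (X x) * c.eta x (Y x) = p
    generalize (-1 : ℝ) ^ r = ε at *
    -- The `η⊗η`-coefficient is `hb`. The `g`-coefficient is one third of the trace equation `hμ`,
    -- corrected by `hb` for the trace of `η⊗η`.
    linear_combination (-p / 2 + g * ε / 6) * hb + g / 3 * hμ - g * H / 3 * e1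

end SpinStructure

end Spin

end SqK

/-! ### The main theorem: rescaling and choice of sign. -/

theorem mainTheorem3 {M : Type*} [TopologicalSpace M] [T2Space M] [SecondCountableTopology M]
    [ChartedSpace SqK.E3 M] [IsManifold 𝓘(ℝ, SqK.E3) ∞ M]
    (r : ℕ) (hr : r = 0 ∨ r = 1) (c : SqK.ContactMetric M r) (H : ℝ)
    (hc : SqK.IsSasakianSpaceForm c H)
    {ι : Type*} (S : SqK.SpinStructure c ι)
    (t : SqK.Kind) (ht : t.Admissible r H)
    (hlam : t.lam r H ≠ 0)
    (hscal : ∀ i, ∀ x ∈ S.U i, S.scalar i x - 6 * t.Lam r H ≠ 0)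
    (psi : ι → M → (Fin 2 → ℂ)) (hpsi : S.IsSqK (t.a r H) (t.b r H) psi) (hnull : S.NonNull psi) :
    (r = 0 → S.RatioPos (t.lam r H) (t.Lam r H) psi) ∧
    (S.RatioPos (t.lam r H) (t.Lam r H) psi →
      S.SolvesED (t.lam r H) (t.Lam r H) (S.rescale (t.lam r H) (t.Lam r H) psi)) ∧
    (r = 1 → ∃ chi : ι → M → (Fin 2 → ℂ),
      S.IsSqK (t.a r H) (t.b r H) chi ∧
      (∀ i, ∀ x ∈ S.U i, SqK.sq r (chi i x) = -SqK.sq r (psi i x)) ∧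
      ((S.RatioPos (t.lam r H) (t.Lam r H) psi ∧
          S.SolvesED (t.lam r H) (t.Lam r H) (S.rescale (t.lam r H) (t.Lam r H) psi)) ∨
        (S.RatioPos (t.lam r H) (t.Lam r H) chi ∧
          S.SolvesED (t.lam r H) (t.Lam r H) (S.rescale (t.lam r H) (t.Lam r H) chi)))) := by
  have := hc.simplyConnected
  obtain ⟨μ, hμ, hb, hneg⟩ := t.exists_scal_sub_eq hr ht
  have hS : ∀ i, ∀ x ∈ S.U i, S.scalar i x - 6 * t.Lam r H = μ * t.lam r H := fun i x hx ↦ by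
    rw [← hμ, SqK.SpinStructure.scalar, SqK.ContactMetric.scal_eq hr hc (S.isFrameAt hx)]
  have hratio : ∀ (p : ι → M → (Fin 2 → ℂ)), ∀ i, ∀ x ∈ S.U i,
      S.ratio (t.lam r H) (t.Lam r H) p i x = -μ / SqK.sq r (p i x) := fun p i x hx ↦ by
    rw [SqK.SpinStructure.ratio, hS i x hx, mul_comm μ, ← mul_neg, mul_div_mul_left _ _ hlam]
  have hsolve : ∀ p : ι → M → (Fin 2 → ℂ), S.IsSqK (t.a r H) (t.b r H) p →
      S.RatioPos (t.lam r H) (t.Lam r H) p →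
      S.SolvesED (t.lam r H) (t.Lam r H) (S.rescale (t.lam r H) (t.Lam r H) p) := by
    intro p hp hpos
    obtain ⟨q, hq⟩ := hp.exists_sq_eq hr
    -- Both `(S-6Λ)/λ = μ` and `⟨p,p⟩ = q` are constant, so the rescaling is by a constant on the
    -- sets `U i` and preserves the spinor equation there; the rescaled length is `(-μ/q) q = -μ`.
    have hresc : ∀ i, ∀ x ∈ S.U i, S.rescale (t.lam r H) (t.Lam r H) p i x
        = ((Real.sqrt (-μ / q) : ℝ) : ℂ) • p i x := fun i x hx ↦ by
      rw [SqK.SpinStructure.rescale, hratio p i x hx, hq i x hx]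
    refine ((hp.smul (Real.sqrt (-μ / q))).congr hresc).solvesED hr hc (t.lam_eq hr) hμ hb ?_
    intro i x hx
    have h := hpos i x hx
    rw [hratio p i x hx, hq i x hx] at h
    have hq0 : q ≠ 0 := by rintro rfl; simp at h
    rw [hresc i x hx, SqK.sq_smul, Real.mul_self_sqrt h.le, hq i x hx, div_mul_cancel₀ _ hq0]
  refine ⟨?_, hsolve psi hpsi, ?_⟩
  · rintro rfl i x hx
    rw [hratio psi i x hx]
    exact div_pos (neg_pos.2 (hneg rfl)) (SqK.sq_pos_riemannian (hnull i x hx))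
  · rintro rfl
    have hchi : S.IsSqK (t.a 1 H) (t.b 1 H) fun i x ↦ SqK.realStr (psi i x) :=
      hpsi.map SqK.commutes_realStr_gam SqK.commutes_realStr_gam_mul_gam fun i j x hx ↦
        SqK.commutes_realStr_spin (S.det_h i j x hx) (S.isometry_h i j x hx)
    refine ⟨_, hchi, fun i x _ ↦ SqK.sq_realStr _, ?_⟩
    obtain ⟨q, hq⟩ := hpsi.exists_sq_eq hr
    obtain ⟨x₀⟩ := (inferInstance : Nonempty M)
    obtain ⟨i₀, hx₀⟩ := S.cover x₀
    have hq0 : q ≠ 0 := hq i₀ x₀ hx₀ ▸ hnull i₀ x₀ hx₀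
    have hμ0 : μ ≠ 0 := by
      rintro rfl
      exact hscal i₀ x₀ hx₀ (by rw [hS i₀ x₀ hx₀, zero_mul])
    -- The ratio of `psi` is the nonzero constant `-μ/q`, and that of its image under the real
    -- structure is the opposite constant.
    rcases (div_ne_zero (neg_ne_zero.2 hμ0) hq0).lt_or_gt with h | h
    · have hpos : S.RatioPos (t.lam 1 H) (t.Lam 1 H) fun i x ↦ SqK.realStr (psi i x) := by
        intro i x hx
        rw [hratio _ i x hx, SqK.sq_realStr, hq i x hx, div_neg]
        exact neg_pos.2 h
      exact Or.inr ⟨hpos, hsolve _ hchi hpos⟩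
    · have hpos : S.RatioPos (t.lam 1 H) (t.Lam 1 H) psi := by
        intro i x hx
        rw [hratio _ i x hx, hq i x hx]
        exact h
      exact Or.inl ⟨hpos, hsolve _ hpsi hpos⟩
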